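/- **Setting.** Let $d\in\mathbb{N}$, $d\ge 1$, and let $\Omega\subseteq\mathbb{R}^d$ be a bounded Lipschitz domain with boundary $\partial\Omega=\Gamma_D\cup\Gamma_N$, $\Gamma_D\cap\Gamma_N=\emptyset$, where $\Gamma_D$ is closed and has positive $(d-1)$-dimensional Hausdorff measure. Let $\mathcal{T}_h$ be a finite conforming triangulation of $\overline\Omega$ into closed $d$-simplices, and let $\mathcal{S}_h$ be the set of its sides (the $(d-1)$-dimensional faces): a side is interior if it is shared by two elements, and a boundary side if it is contained in $\partial\Omega$. Let $x_S$ be the barycenter of $S\in\mathcal{S}_h$ and $n_T$ the outward unit normal of $T\in\mathcal{T}_h$. Let $\mathcal{L}^k(\mathcal{T}_h)$ be the space of element-wise polynomial functions of degree at most $k$ (no continuity required), let $\nabla_h$ be the element-wise gradient, and let $\Pi_h$ map an integrable function to the element-wise constant function of its integral means over the elements. Set $$\mathcal{S}^{1,cr}_D(\mathcal{T}_h)=\{v\in\mathcal{L}^1(\mathcal{T}_h)\mid v \text{ is continuous at } x_S \text{ for all interior sides } S,\ v(x_S)=0\text{ for all boundary sides } S\subseteq\Gamma_D\},$$ and let $\mathcal{R}T^0_N(\mathcal{T}_h)$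 be the set of all $y\in\mathcal{L}^1(\mathcal{T}_h)^d$ such that $y|_T\cdot n_T$ is constant on each side of $T$ for all $T\in\mathcal{T}_h$, $y|_{T}\cdot n_{T}+y|_{T'}\cdot n_{T'}=0$ on every interior side shared by $T$ and $T'$, and $y\cdot n=0$ on $\Gamma_N$. For such $y$, $\operatorname{div}y\in\mathcal{L}^0(\mathcal{T}_h)$ is computed element by element. Let $\delta\ge 0$, let $p\in C^0(\overline\Omega)$ with $p>1$ on $\overline\Omega$, let $f\in L^{p'(\cdot)}(\Omega)$ with $p'=p/(p-1)$, and let $f_h=\Pi_hf$. For every $T\in\mathcal{T}_h$ fix any $\xi_T\in T$, and for $x\in T$, $a\in\mathbb{R}^d$, $t\ge0$ put $$\mathcal{A}_h(x,a)=(\delta+|a|)^{p(\xi_T)-2}a,\qquad \varphi_h(x,t)=\int_0^t(\delta+s)^{p(\xi_T)-2}s\,ds,\qquad \varphi_h^*(x,t)=\sup_{s\ge0}\big(st-\varphi_h(x,s)\big).$$ For $v\in\mathcal{S}^{1,cr}_D(\mathcal{T}_h)$ and $y\in\mathcal{R}T^0_N(\mathcal{T}_h)$ define $$I_h^{cr}(v)=\int_\Omega\varphi_h(\cdot,|\nabla_hv|)\,dx-\int_\Omega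 f_h\,\Pi_hv\,dx,\qquad D_h^{rt}(y)=\begin{cases}-\int_\Omega\varphi_h^*(\cdot,|\Pi_hy|)\,dx&\text{if }\operatorname{div}y=-f_h\text{ a.e. in }\Omega,\\-\infty&\text{otherwise.}\end{cases}$$ Let $u_h^{cr}\in\mathcal{S}^{1,cr}_D(\mathcal{T}_h)$ denote the solution of $$\int_\Omega\mathcal{A}_h(\cdot,\nabla_hu_h^{cr})\cdot\nabla_hv\,dx=\int_\Omega f_h\,\Pi_hv\,dx\qquad\text{for all }v\in\mathcal{S}^{1,cr}_D(\mathcal{T}_h).$$ **Proposition.** (i) (Discrete weak duality) $\displaystyle\inf_{v\in\mathcal{S}^{1,cr}_D(\mathcal{T}_h)}I_h^{cr}(v)\ \ge\ \sup_{y\in\mathcal{R}T^0_N(\mathcal{T}_h)}D_h^{rt}(y)$. (ii) The field $z_h^{rt}\in\mathcal{L}^1(\mathcal{T}_h)^d$ defined by the generalized Marini formula $$z_h^{rt}=\mathcal{A}_h(\cdot,\nabla_hu_h^{cr})-\frac{f_h}{d}\big(\mathrm{id}_{\mathbb{R}^d}-\Pi_h\mathrm{id}_{\mathbb{R}^d}\big)$$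 belongs to $\mathcal{R}T^0_N(\mathcal{T}_h)$ and satisfies $\operatorname{div}z_h^{rt}=-f_h$ and $\Pi_hz_h^{rt}=\mathcal{A}_h(\cdot,\nabla_hu_h^{cr})$ a.e. in $\Omega$. (iii) $z_h^{rt}$ is the unique maximizer of $D_h^{rt}$ over $\mathcal{R}T^0_N(\mathcal{T}_h)$, and discrete strong duality holds: $I_h^{cr}(u_h^{cr})=D_h^{rt}(z_h^{rt})$. -/

import Mathlib

open MeasureTheory
open scoped NNReal

noncomputable section

namespace DiscreteDuality

/-- Euclidean space of dimension `d`. -/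
abbrev Pt (d : ℕ) := EuclideanSpace ℝ (Fin d)

/-! ### Domains and triangulations -/

/-- Bounded Lipschitz domains: near each boundary point, `Ω` is the set of the points that lie, in
the direction of some unit vector `ν`, strictly above the graph of a Lipschitz function of the
coordinates orthogonal to `ν` (that is, of a Lipschitz function `γ` invariant along `ν`). -/
structure IsBoundedLipschitzDomain {d : ℕ} (Ω : Set (Pt d)) : Prop where
  isOpen : IsOpen Ω
  isConnected : IsConnected Ω
  isBounded : Bornology.IsBounded Ω
  lipschitz : ∀ x ∈ frontier Ω, ∃ (ν : Pt d) (r : ℝ) (L : ℝ≥0) (γ : Pt d → ℝ),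
    ‖ν‖ = 1 ∧ 0 < r ∧ LipschitzWith L γ ∧ (∀ (y : Pt d) (t : ℝ), γ (y + t • ν) = γ y) ∧
      ∀ y ∈ Metric.ball x r, (y ∈ Ω ↔ γ y < inner ℝ ν y)

/-- A (conforming, finite, simplicial) triangulation of `Ω`: a finite simplicial complex, each of
whose faces is a face of a full-dimensional simplex, with underlying space `closure Ω`. -/
structure Triangulation {d : ℕ} (Ω : Set (Pt d)) where
  complex : Geometry.SimplicialComplex ℝ (Pt d)
  finite_faces : complex.faces.Finite
  pure_dim : ∀ s ∈ complex.faces, ∃ t ∈ complex.faces, s ⊆ t ∧ t.card = d + 1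
  space_eq : complex.space = closure Ω

namespace Triangulation

variable {d : ℕ} {Ω : Set (Pt d)}

/-- The elements, given by their `d + 1` vertices. -/
abbrev Elem (𝒯 : Triangulation Ω) := {s : Finset (Pt d) // s ∈ 𝒯.complex.faces ∧ s.card = d + 1}

/-- The sides, given by their `d` vertices. -/
abbrev Side (𝒯 : Triangulation Ω) := {s : Finset (Pt d) // s ∈ 𝒯.complex.faces ∧ s.card = d}

instance finite_elem (𝒯 : Triangulation Ω) : Finite 𝒯.Elem :=
  (𝒯.finite_faces.subset (fun _ h => h.1) :
    {s : Finset (Pt d) | s ∈ 𝒯.complex.faces ∧ s.card = d + 1}.Finite).to_subtype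

instance fintype_elem (𝒯 : Triangulation Ω) : Fintype 𝒯.Elem := Fintype.ofFinite _

/-- The closed simplex spanned by a finite set of vertices. -/
abbrev hull (s : Finset (Pt d)) : Set (Pt d) := convexHull ℝ (s : Set (Pt d))

/-- The barycenter of a side. -/
def sideBarycenter (S : Finset (Pt d)) : Pt d := (d : ℝ)⁻¹ • ∑ ν ∈ S, ν

/-- `S` is an interior side, shared by the two adjacent elements `T₁` and `T₂`. -/
def IsInteriorSide (𝒯 : Triangulation Ω) (S : 𝒯.Side) (T₁ T₂ : 𝒯.Elem) : Prop :=
  T₁ ≠ T₂ ∧ S.1 ⊆ T₁.1 ∧ S.1 ⊆ T₂.1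

/-- `S` is a boundary side and `T` is the element it belongs to. -/
def IsBoundarySide (𝒯 : Triangulation Ω) (S : 𝒯.Side) (T : 𝒯.Elem) : Prop :=
  S.1 ⊆ T.1 ∧ hull S.1 ⊆ frontier Ω

/-- `n` is the outward unit normal vector of the simplex `T` on its side `S`. -/
def IsOutwardNormal (T S : Finset (Pt d)) (n : Pt d) : Prop :=
  ‖n‖ = 1 ∧ (∀ x ∈ S, ∀ y ∈ S, inner ℝ n (y - x) = 0) ∧
    ∀ x ∈ S, ∀ y ∈ T, y ∉ S → inner ℝ n (y - x) < 0

/-! ### Element-wise polynomial functions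

An element-wise polynomial function, as an element of `L^∞(Ω)`, is nothing but a family of
polynomials, one for each element: `v T` stands for the restriction of `v` to `T`. -/

/-- Element-wise constant functions with values in `F`. -/
abbrev L0 (𝒯 : Triangulation Ω) (F : Type*) := 𝒯.Elem → F

/-- Element-wise affine functions with values in `F`. -/
abbrev L1 (𝒯 : Triangulation Ω) (F : Type*) [AddCommGroup F] [Module ℝ F] :=
  𝒯.Elem → (Pt d →ᵃ[ℝ] F)

section Functions

variable {F : Type*} [NormedAddCommGroup F] [NormedSpace ℝ F]

/-- The function on `Ω` made up of the given functions on the elements, `∑_T χ_T w_T`. It is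
defined up to the null set that the boundaries of the elements form (it is set to zero there). -/
def glue (𝒯 : Triangulation Ω) (w : 𝒯.Elem → Pt d → F) (x : Pt d) : F :=
  ∑ T : 𝒯.Elem, (interior (hull T.1)).indicator (w T) x

/-- The function on `Ω` given by an element-wise constant function. -/
def fn0 (𝒯 : Triangulation Ω) (w : 𝒯.L0 F) : Pt d → F := 𝒯.glue (fun T _ => w T)

/-- The function on `Ω` given by an element-wise affine function. -/
def fn1 (𝒯 : Triangulation Ω) (v : 𝒯.L1 F) : Pt d → F := 𝒯.glue (fun T x => v T x)

/-- The local `L²`-projection onto element-wise constants: the integral mean over each element. -/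
def proj (𝒯 : Triangulation Ω) (v : Pt d → F) : 𝒯.L0 F := fun T => ⨍ x in hull T.1, v x

end Functions

/-- The element-wise gradient. -/
def grad (𝒯 : Triangulation Ω) (v : 𝒯.L1 ℝ) : 𝒯.L0 (Pt d) := fun T => gradient (v T) 0

/-- The divergence of an element-wise affine vector field, computed element by element. -/
def div (𝒯 : Triangulation Ω) (y : 𝒯.L1 (Pt d)) : 𝒯.L0 ℝ :=
  fun T => LinearMap.trace ℝ (Pt d) (y T).linear

/-! ### Finite element spaces -/

/-- The Crouzeix--Raviart space: element-wise affine functions that are continuous at the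
barycenters of the interior sides. -/
def CR (𝒯 : Triangulation Ω) : Set (𝒯.L1 ℝ) :=
  {v | ∀ S T₁ T₂, 𝒯.IsInteriorSide S T₁ T₂ →
    v T₁ (sideBarycenter S.1) - v T₂ (sideBarycenter S.1) = 0}

/-- The Crouzeix--Raviart functions that vanish at the barycenters of the boundary sides
contained in the Dirichlet part `ΓD`. -/
def CRD (𝒯 : Triangulation Ω) (ΓD : Set (Pt d)) : Set (𝒯.L1 ℝ) :=
  {v | v ∈ 𝒯.CR ∧ ∀ S T, 𝒯.IsBoundarySide S T → hull S.1 ⊆ ΓD →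
    v T (sideBarycenter S.1) = 0}

/-- The lowest order Raviart--Thomas space: element-wise affine vector fields whose normal
component is constant on each side of each element, with zero normal jump across the interior
sides. -/
def RT (𝒯 : Triangulation Ω) : Set (𝒯.L1 (Pt d)) :=
  {y | (∀ (S : 𝒯.Side) (T : 𝒯.Elem) (n : Pt d), S.1 ⊆ T.1 → IsOutwardNormal T.1 S.1 n →
      ∃ c : ℝ, ∀ x ∈ hull S.1, inner ℝ (y T x) n = c) ∧
    ∀ S T₁ T₂, 𝒯.IsInteriorSide S T₁ T₂ → ∀ n₁ n₂ : Pt d,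
      IsOutwardNormal T₁.1 S.1 n₁ → IsOutwardNormal T₂.1 S.1 n₂ →
        ∀ x ∈ hull S.1, inner ℝ (y T₁ x) n₁ + inner ℝ (y T₂ x) n₂ = 0}

/-- The Raviart--Thomas fields with zero normal component on the Neumann part `∂Ω ∖ ΓD`. -/
def RTN (𝒯 : Triangulation Ω) (ΓD : Set (Pt d)) : Set (𝒯.L1 (Pt d)) :=
  {y | y ∈ 𝒯.RT ∧ ∀ S T, 𝒯.IsBoundarySide S T → ∀ n : Pt d, IsOutwardNormal T.1 S.1 n →
    ∀ x ∈ hull S.1 ∩ (frontier Ω \ ΓD), inner ℝ (y T x) n = 0}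

end Triangulation

/-! ### The non-linearity -/

/-- `f ∈ L^{q(·)}(Ω)` for a bounded exponent `q`: `f` is measurable with finite modular. -/
def MemVarLp {d : ℕ} (Ω : Set (Pt d)) (q : Pt d → ℝ) (f : Pt d → ℝ) : Prop :=
  AEMeasurable f (volume.restrict Ω) ∧ ∫⁻ x in Ω, ENNReal.ofReal (|f x| ^ q x) < ⊤

/-- `𝒜(a) = (δ + |a|)^{q-2} a`, for a fixed value `q` of the exponent. -/
def opA {d : ℕ} (δ q : ℝ) (a : Pt d) : Pt d := (δ + ‖a‖) ^ (q - 2) • a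

/-- `φ(t) = ∫_0^t (δ + s)^{q-2} s ds`, for a fixed value `q` of the exponent. -/
def phi (δ q t : ℝ) : ℝ := ∫ s in (0 : ℝ)..t, (δ + s) ^ (q - 2) * s

/-- The Fenchel conjugate `ψ*(t) = sup_{s ≥ 0} (s t - ψ(s))`. -/
def conj (ψ : ℝ → ℝ) (t : ℝ) : ℝ := sSup ((fun s => s * t - ψ s) '' Set.Ici 0)

/-- The modular `∫_Ω ψ(x, |w(x)|) dx`. -/
def modular {d : ℕ} (Ω : Set (Pt d)) (ψ : Pt d → ℝ → ℝ) (w : Pt d → Pt d) : ℝ :=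
  ∫ x in Ω, ψ x ‖w x‖

/-- The indicator functional `I_{g}` of convex analysis: `0` at functions equal to `g` almost
everywhere in `Ω`, and `+∞` elsewhere. -/
def indicatorFunctional {d : ℕ} (Ω : Set (Pt d)) (g h : Pt d → ℝ) : EReal :=
  open Classical in if h =ᵐ[volume.restrict Ω] g then 0 else ⊤

/-! ### The discrete problems

`δ ≥ 0` is the shift, `p` the variable exponent, `ξ` the choice of a quadrature point in each
element, and `f` the right-hand side. -/

namespace Triangulation

variable {d : ℕ} {Ω : Set (Pt d)}

/-- The element-wise constant exponent `p_h`, equal to `p(ξ_T)` on `T`. -/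
def expo (𝒯 : Triangulation Ω) (p : Pt d → ℝ) (ξ : 𝒯.Elem → Pt d) : Pt d → ℝ :=
  𝒯.fn0 (fun T => p (ξ T))

/-- `u` solves the Crouzeix--Raviart approximation:
`(𝒜_h(·,∇_h u), ∇_h v)_Ω = (Π_h f, Π_h v)_Ω` for all `v` in the Crouzeix--Raviart space. -/
def IsDiscreteSolution (𝒯 : Triangulation Ω) (ΓD : Set (Pt d)) (δ : ℝ) (p : Pt d → ℝ)
    (ξ : 𝒯.Elem → Pt d) (f : Pt d → ℝ) (u : 𝒯.L1 ℝ) : Prop :=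
  u ∈ 𝒯.CRD ΓD ∧ ∀ v ∈ 𝒯.CRD ΓD,
    ∫ x in Ω, inner ℝ (opA δ (𝒯.expo p ξ x) (𝒯.fn0 (𝒯.grad u) x)) (𝒯.fn0 (𝒯.grad v) x) =
      ∫ x in Ω, 𝒯.fn0 (𝒯.proj f) x * 𝒯.fn0 (𝒯.proj (𝒯.fn1 v)) x

/-- The discrete primal energy
`I_h(v) = ∫_Ω φ_h(·,|∇_h v|) dx - (Π_h f, Π_h v)_Ω`. -/
def primal (𝒯 : Triangulation Ω) (δ : ℝ) (p : Pt d → ℝ) (ξ : 𝒯.Elem → Pt d) (f : Pt d → ℝ)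
    (v : 𝒯.L1 ℝ) : ℝ :=
  modular Ω (fun x => phi δ (𝒯.expo p ξ x)) (𝒯.fn0 (𝒯.grad v)) -
    ∫ x in Ω, 𝒯.fn0 (𝒯.proj f) x * 𝒯.fn0 (𝒯.proj (𝒯.fn1 v)) x

/-- The discrete dual energy
`D_h(y) = -∫_Ω φ_h^*(·,|Π_h y|) dx - I_{-Π_h f}(div y)`, with values in `ℝ ∪ {-∞}`. -/
def dual (𝒯 : Triangulation Ω) (δ : ℝ) (p : Pt d → ℝ) (ξ : 𝒯.Elem → Pt d) (f : Pt d → ℝ)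
    (y : 𝒯.L1 (Pt d)) : EReal :=
  -((modular Ω (fun x => conj (phi δ (𝒯.expo p ξ x))) (𝒯.fn0 (𝒯.proj (𝒯.fn1 y))) : ℝ) : EReal) -
    indicatorFunctional Ω (fun x => -𝒯.fn0 (𝒯.proj f) x) (𝒯.fn0 (𝒯.div y))

/-- The generalized Marini formula `z = 𝒜_h(·,∇_h u) - (Π_h f / d) (id - Π_h id)`. -/
def marini (𝒯 : Triangulation Ω) (δ : ℝ) (p : Pt d → ℝ) (ξ : 𝒯.Elem → Pt d) (f : Pt d → ℝ)
    (u : 𝒯.L1 ℝ) : 𝒯.L1 (Pt d) := fun T =>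
  AffineMap.const ℝ (Pt d) (opA δ (p (ξ T)) (𝒯.grad u T)) -
    (𝒯.proj f T / (d : ℝ)) •
      (AffineMap.id ℝ (Pt d) - AffineMap.const ℝ (Pt d) (𝒯.proj (fun x : Pt d => x) T))

end Triangulation

end DiscreteDuality

end

/-! Everything reduces to finite sums over elements: the elements have disjoint interiors and fill
`Ω` up to a null set, and the mean of an affine function over a simplex is its value at the average
of the vertices (`IsSimplex.setIntegral_affine`). On an element T, let λ_a be the barycentric
coordinate `bary T a`. Its gradient is a negative multiple of the outward normal on the side
opposite a, and vol(T)∇λ_a is the area-weighted normal divided by -d. Normal components can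
therefore be expressed through the derivatives of the λ_a, and no surface measure is needed.

In these terms the divergence theorem on a simplex is algebra (`gauss_formula`). Summed over the
elements and regrouped by sides, its right-hand side vanishes: on an interior side the fluxes are
opposite and v is continuous at the barycenter; on a boundary side either v or the flux vanishes.
This is integration by parts (`sum_gauss`). Hence, for admissible v and y with div y = -f_h, the gap
I(v) - D(y) is the sum of vol(T) times φ(|∇v|) + φ*(|Πy|) - Πy·∇v (`duality_gap`). Each term is
nonnegative by Fenchel-Young, which is weak duality. For v = u and y = z every term is zero because
Πz = A(∇u), which is strong duality. If some other y attains the primal value, all terms vanish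
again; strict convexity then determines Πy and the divergence determines the slope, so y = z
(`eq_marini_of_primal_le_dual`).

That z is a Raviart-Thomas field follows by testing the discrete equation with the Crouzeix-Raviart
basis function of one side: the Gauss formula isolates that side and shows that the fluxes of z
through it add up to zero (`sum_marini_normal`). This uses that a boundary side has one adjacent
element, and any other side exactly two, lying opposite to each other. The Lipschitz graph condition
enters only through int(closure Ω) = Ω. -/

noncomputable section

namespace DiscreteDuality

/-! ### The scalar non-linearity and its Fenchel conjugate -/

/-- The derivative `ψ(s) = (δ + s)^{q-2} s` of `phi`. -/
def dphi (δ q s : ℝ) : ℝ := (δ + s) ^ (q - 2) * s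

section Scalar

variable {δ q : ℝ}

@[simp] lemma dphi_zero : dphi δ q 0 = 0 := by simp [dphi]

/-- Since q - 2 may be negative, monotonicity is not visible in the definition. Here both factors
are monotone: a positive power, and s/(δ+s). -/
lemma dphi_eq_of_pos (hδ : 0 ≤ δ) {s : ℝ} (hs : 0 < s) :
    dphi δ q s = (δ + s) ^ (q - 1) * (s / (δ + s)) := by
  have h : 0 < δ + s := by linarith
  rw [dphi, show q - 1 = (q - 2) + 1 by ring, Real.rpow_add_one h.ne']
  field_simp

lemma dphi_strictMonoOn (hδ : 0 ≤ δ) (hq : 1 < q) : StrictMonoOn (dphi δ q) (Set.Ici 0) := by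
  intro s hs t ht hst
  have hs0 : 0 ≤ s := hs
  have htpos : 0 < t := lt_of_le_of_lt hs0 hst
  rcases hs0.eq_or_lt with rfl | hspos
  · rw [dphi_zero, dphi]
    positivity
  · rw [dphi_eq_of_pos hδ hspos, dphi_eq_of_pos hδ htpos]
    have h1 : 0 < δ + s := by linarith
    have h2 : 0 < δ + t := by linarith
    refine mul_lt_mul (Real.rpow_lt_rpow h1.le (by linarith) (by linarith)) ?_ (by positivity)
      (by positivity)
    rw [div_le_div_iff₀ h1 h2]
    nlinarith

lemma dphi_continuousOn (hδ : 0 ≤ δ) (hq : 1 < q) : ContinuousOn (dphi δ q) (Set.Ici 0) := by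
  -- For δ = 0 the factor s^(q-2) is singular at 0 when q < 2; the product is s^(q-1), which is
  -- continuous.
  rcases hδ.eq_or_lt with rfl | hδ
  · have h : Set.EqOn (dphi 0 q) (fun s => s ^ (q - 1)) (Set.Ici 0) := by
      intro s hs
      rcases (show (0 : ℝ) ≤ s from hs).eq_or_lt with rfl | hs
      · simp [Real.zero_rpow (by linarith : q - 1 ≠ 0)]
      · rw [dphi_eq_of_pos le_rfl hs]
        simp [hs.ne']
    refine ContinuousOn.congr ?_ h
    exact (Real.continuous_rpow_const (by linarith)).continuousOn
  · refine ContinuousOn.mul (ContinuousOn.rpow_const (by fun_prop) ?_) continuousOn_id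
    intro s hs
    left
    have : (0 : ℝ) ≤ s := hs
    linarith

lemma exists_dphi_eq (hδ : 0 ≤ δ) (hq : 1 < q) {t : ℝ} (ht : 0 ≤ t) :
    ∃ s, 0 ≤ s ∧ dphi δ q s = t := by
  -- The threshold 2t compensates for the factor R/(δ+R), which is at least 1/2 once R ≥ δ.
  obtain ⟨M, hM⟩ := Filter.eventually_atTop.1
    ((tendsto_rpow_atTop (show 0 < q - 1 by linarith)).eventually_ge_atTop (2 * t))
  set R := max M (max δ 1) with hR
  have hR1 : 1 ≤ R := (le_max_right _ _).trans (le_max_right _ _)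
  have hRδ : δ ≤ R := (le_max_left _ _).trans (le_max_right _ _)
  have hle : t ≤ dphi δ q R := by
    rw [dphi_eq_of_pos hδ (by linarith)]
    have h1 : 2 * t ≤ (δ + R) ^ (q - 1) := (hM R (le_max_left _ _)).trans
      (Real.rpow_le_rpow (by linarith) (by linarith) (by linarith))
    have h2 : 1 / 2 ≤ R / (δ + R) := by
      rw [div_le_div_iff₀ two_pos (by linarith)]
      linarith
    calc t = (2 * t) * (1 / 2) := by ring
      _ ≤ _ := mul_le_mul h1 h2 (by norm_num) (by positivity)
  obtain ⟨s, hs, hst⟩ := intermediate_value_Icc (show (0 : ℝ) ≤ R by linarith)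
    ((dphi_continuousOn hδ hq).mono Set.Icc_subset_Ici_self) ⟨by simpa using ht, hle⟩
  exact ⟨s, hs.1, hst⟩

lemma dphi_intervalIntegrable (hδ : 0 ≤ δ) (hq : 1 < q) {r s : ℝ} (hr : 0 ≤ r) (hs : 0 ≤ s) :
    IntervalIntegrable (dphi δ q) volume r s :=
  ((dphi_continuousOn hδ hq).mono fun _ hx => (le_min hr hs).trans hx.1).intervalIntegrable

lemma phi_sub_phi (hδ : 0 ≤ δ) (hq : 1 < q) {r s : ℝ} (hr : 0 ≤ r) (hs : 0 ≤ s) :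
    phi δ q s - phi δ q r = ∫ x in r..s, dphi δ q x :=
  intervalIntegral.integral_interval_sub_left (dphi_intervalIntegrable hδ hq le_rfl hs)
    (dphi_intervalIntegrable hδ hq le_rfl hr)

/-- Strict convexity of `phi`: its graph lies strictly above its tangents. -/
lemma phi_tangent_lt (hδ : 0 ≤ δ) (hq : 1 < q) {r s : ℝ} (hr : 0 ≤ r) (hs : 0 ≤ s) (hrs : s ≠ r) :
    phi δ q r + dphi δ q r * (s - r) < phi δ q s := by
  have hmono := dphi_strictMonoOn hδ hq
  have hi := dphi_intervalIntegrable (δ := δ) (q := q) hδ hq hr hs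
  have hsub := phi_sub_phi (δ := δ) (q := q) hδ hq hr hs
  rcases lt_or_gt_of_ne hrs with h | h
  · have := intervalIntegral.intervalIntegral_pos_of_pos_on
      (f := fun x => dphi δ q r - dphi δ q x) (intervalIntegrable_const.sub hi.symm)
      (fun x hx => sub_pos.2 (hmono (show 0 ≤ x from hs.trans hx.1.le) hr hx.2)) h
    rw [intervalIntegral.integral_sub intervalIntegrable_const hi.symm,
      intervalIntegral.integral_const, intervalIntegral.integral_symm r s, ← hsub] at this
    simp only [smul_eq_mul] at this
    linarith
  · have := intervalIntegral.intervalIntegral_pos_of_pos_on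
      (f := fun x => dphi δ q x - dphi δ q r) (hi.sub intervalIntegrable_const)
      (fun x hx => sub_pos.2 (hmono hr (show 0 ≤ x from hr.trans hx.1.le) hx.1)) h
    rw [intervalIntegral.integral_sub hi intervalIntegrable_const,
      intervalIntegral.integral_const, ← hsub] at this
    simp only [smul_eq_mul] at this
    linarith

/-- The tangent inequality at r. As every t ≥ 0 is a value of `dphi`, the supremum in `conj` is
always an attained maximum, never the default value of `sSup`. -/
lemma conj_isGreatest (hδ : 0 ≤ δ) (hq : 1 < q) {r : ℝ} (hr : 0 ≤ r) :
    IsGreatest ((fun s => s * dphi δ q r - phi δ q s) '' Set.Ici 0)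
      (r * dphi δ q r - phi δ q r) := by
  refine ⟨⟨r, hr, rfl⟩, ?_⟩
  rintro _ ⟨s, hs, rfl⟩
  rcases eq_or_ne s r with rfl | h
  · exact le_rfl
  · have := phi_tangent_lt hδ hq hr hs h
    simp only
    linarith

lemma conj_dphi (hδ : 0 ≤ δ) (hq : 1 < q) {r : ℝ} (hr : 0 ≤ r) :
    conj (phi δ q) (dphi δ q r) = r * dphi δ q r - phi δ q r :=
  (conj_isGreatest hδ hq hr).csSup_eq

/-- Young's inequality. -/
lemma mul_le_phi_add_conj (hδ : 0 ≤ δ) (hq : 1 < q) {s t : ℝ} (hs : 0 ≤ s) (ht : 0 ≤ t) :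
    s * t ≤ phi δ q s + conj (phi δ q) t := by
  obtain ⟨r, hr, rfl⟩ := exists_dphi_eq hδ hq ht
  have : s * dphi δ q r - phi δ q s ≤ conj (phi δ q) (dphi δ q r) := by
    rw [conj_dphi hδ hq hr]
    exact (conj_isGreatest hδ hq hr).2 ⟨s, hs, rfl⟩
  linarith

/-- Writing t as the slope at r, equality means that the tangent at r meets the graph at s; strict
convexity forces s = r. -/
lemma eq_dphi_of_young_eq (hδ : 0 ≤ δ) (hq : 1 < q) {s t : ℝ} (hs : 0 ≤ s) (ht : 0 ≤ t)
    (h : phi δ q s + conj (phi δ q) t ≤ s * t) : t = dphi δ q s := by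
  obtain ⟨r, hr, rfl⟩ := exists_dphi_eq hδ hq ht
  rw [conj_dphi hδ hq hr] at h
  by_contra hne
  have hsr : s ≠ r := fun h => hne (by rw [h])
  have := phi_tangent_lt hδ hq hr hs hsr
  linarith

variable {d : ℕ}

lemma norm_opA (hδ : 0 ≤ δ) (a : Pt d) : ‖opA δ q a‖ = dphi δ q ‖a‖ := by
  rw [opA, norm_smul, Real.norm_of_nonneg (by positivity), dphi]

lemma inner_opA_self (a : Pt d) : inner ℝ (opA δ q a) a = ‖a‖ * dphi δ q ‖a‖ := by
  rw [opA, real_inner_smul_left, real_inner_self_eq_norm_sq, dphi]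
  ring

/-- The vectorial Fenchel identity. -/
lemma phi_add_conj_opA (hδ : 0 ≤ δ) (hq : 1 < q) (a : Pt d) :
    phi δ q ‖a‖ + conj (phi δ q) ‖opA δ q a‖ = inner ℝ (opA δ q a) a := by
  rw [norm_opA hδ, conj_dphi hδ hq (norm_nonneg a), inner_opA_self]
  ring

/-- The vectorial Fenchel--Young inequality. -/
lemma inner_le_phi_add_conj (hδ : 0 ≤ δ) (hq : 1 < q) (a b : Pt d) :
    inner ℝ b a ≤ phi δ q ‖a‖ + conj (phi δ q) ‖b‖ :=
  (real_inner_le_norm b a).trans <| by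
    rw [mul_comm]
    exact mul_le_phi_add_conj hδ hq (norm_nonneg a) (norm_nonneg b)

/-- The equality case of the vectorial Fenchel--Young inequality. -/
lemma eq_opA_of_inner_eq (hδ : 0 ≤ δ) (hq : 1 < q) {a b : Pt d}
    (h : phi δ q ‖a‖ + conj (phi δ q) ‖b‖ ≤ inner ℝ b a) : b = opA δ q a := by
  have h1 := real_inner_le_norm b a
  have h2 := mul_le_phi_add_conj hδ hq (norm_nonneg a) (norm_nonneg b)
  have hb : ‖b‖ = dphi δ q ‖a‖ :=
    eq_dphi_of_young_eq hδ hq (norm_nonneg a) (norm_nonneg b) (by linarith [mul_comm ‖a‖ ‖b‖])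
  have hin : inner ℝ b a = ‖b‖ * ‖a‖ := by linarith [mul_comm ‖a‖ ‖b‖]
  -- Equality also holds in Cauchy-Schwarz, so expanding the square of |b - A(a)| gives zero.
  rw [← sub_eq_zero, ← norm_eq_zero, ← sq_eq_zero_iff, norm_sub_sq_real, norm_opA hδ, opA,
    real_inner_smul_right, hin, hb, dphi]
  ring

end Scalar

end DiscreteDuality

namespace DiscreteDuality

/-! ### Barycentric coordinates on a simplex -/

variable {d : ℕ}

/-- `T` is the vertex set of a full-dimensional simplex. -/
structure IsSimplex (T : Finset (Pt d)) : Prop where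
  indep : AffineIndependent ℝ ((↑) : T → Pt d)
  card_eq : T.card = d + 1

/-- The affine basis formed by the vertices of a simplex. -/
def IsSimplex.basis {T : Finset (Pt d)} (hT : IsSimplex T) : AffineBasis T ℝ (Pt d) where
  toFun := (↑)
  ind' := hT.indep
  tot' := by
    rw [hT.indep.affineSpan_eq_top_iff_card_eq_finrank_add_one]
    simp [hT.card_eq]

open Classical in
/-- The barycentric coordinate of the simplex `T` at its vertex `a`. -/
def bary (T : Finset (Pt d)) (a : Pt d) : Pt d →ᵃ[ℝ] ℝ :=
  if h : IsSimplex T ∧ a ∈ T then h.1.basis.coord ⟨a, h.2⟩ else 0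

/-- The arithmetic mean of the vertices. -/
def center (T : Finset (Pt d)) : Pt d := ((d : ℝ) + 1)⁻¹ • ∑ a ∈ T, a

variable {F : Type*} [NormedAddCommGroup F] [NormedSpace ℝ F]

lemma affineMap_mean (v : Pt d →ᵃ[ℝ] F) {S : Finset (Pt d)} (hS : S.Nonempty) :
    v ((S.card : ℝ)⁻¹ • ∑ a ∈ S, a) = (S.card : ℝ)⁻¹ • ∑ a ∈ S, v a := by
  have h (x : Pt d) : v x = v.linear x + v 0 := congrFun v.decomp x
  have hc : (S.card : ℝ) ≠ 0 := by
    exact_mod_cast hS.card_pos.ne'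
  rw [h, Finset.sum_congr rfl fun a _ => h a, Finset.sum_add_distrib, map_smul, map_sum,
    Finset.sum_const, smul_add, ← Nat.cast_smul_eq_nsmul ℝ, smul_smul, inv_mul_cancel₀ hc, one_smul]

lemma affineMap_sub (v : Pt d →ᵃ[ℝ] F) (x y : Pt d) : v x - v y = v.linear (x - y) :=
  (v.linearMap_vsub x y).symm

lemma affineMap_add_apply (v : Pt d →ᵃ[ℝ] F) (x w : Pt d) : v (x + w) = v x + v.linear w := by
  rw [← sub_eq_iff_eq_add', affineMap_sub, add_sub_cancel_left]

namespace IsSimplex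

variable {T : Finset (Pt d)} (hT : IsSimplex T)

include hT

lemma nonempty : T.Nonempty := by
  rw [← Finset.card_pos, hT.card_eq]
  omega

lemma bary_eq_coord (a : T) : bary T a = hT.basis.coord a := by
  rw [bary, dif_pos ⟨hT, a.2⟩]

lemma bary_self {a : Pt d} (ha : a ∈ T) : bary T a a = 1 := by
  have := hT.basis.coord_apply_eq ⟨a, ha⟩
  rwa [← hT.bary_eq_coord] at this

lemma bary_of_ne {a s : Pt d} (ha : a ∈ T) (hs : s ∈ T) (h : s ≠ a) : bary T a s = 0 := by
  have := hT.basis.coord_apply_ne (i := ⟨a, ha⟩) (j := ⟨s, hs⟩) (by simpa using h.symm)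
  rwa [← hT.bary_eq_coord] at this

lemma sum_bary (x : Pt d) : ∑ a ∈ T, bary T a x = 1 := by
  rw [← hT.basis.sum_coord_apply_eq_one x, ← Finset.sum_coe_sort]
  exact Finset.sum_congr rfl fun a _ => by rw [hT.bary_eq_coord]

lemma sum_bary_smul (x : Pt d) : ∑ a ∈ T, bary T a x • a = x := by
  conv_rhs => rw [← hT.basis.linear_combination_coord_eq_self x]
  rw [← Finset.sum_coe_sort]
  exact Finset.sum_congr rfl fun a _ => by rw [hT.bary_eq_coord]; rfl

lemma apply_eq_sum (v : Pt d →ᵃ[ℝ] F) (x : Pt d) : v x = ∑ a ∈ T, bary T a x • v a := by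
  have h (x : Pt d) : v x = v.linear x + v 0 := congrFun v.decomp x
  rw [h, Finset.sum_congr rfl fun a _ => by rw [h a]]
  simp only [smul_add, Finset.sum_add_distrib, ← Finset.sum_smul, hT.sum_bary, one_smul]
  congr 1
  conv_lhs => rw [← hT.sum_bary_smul x]
  rw [map_sum]
  exact Finset.sum_congr rfl fun a _ => map_smul _ _ _

lemma ext_affine {v w : Pt d →ᵃ[ℝ] F} (h : ∀ a ∈ T, v a = w a) : v = w := by
  ext x
  rw [hT.apply_eq_sum v, hT.apply_eq_sum w]
  exact Finset.sum_congr rfl fun a ha => by rw [h a ha]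

lemma sum_bary_linear (w : Pt d) : ∑ a ∈ T, (bary T a).linear w = 0 := by
  have h := hT.sum_bary (0 + w)
  simp only [affineMap_add_apply, Finset.sum_add_distrib, hT.sum_bary] at h
  linarith

lemma linear_eq_sum (v : Pt d →ᵃ[ℝ] F) (w : Pt d) :
    v.linear w = ∑ a ∈ T, (bary T a).linear w • v a := by
  have h := hT.apply_eq_sum v (0 + w)
  simp only [affineMap_add_apply, add_smul, Finset.sum_add_distrib, ← hT.apply_eq_sum v] at h
  exact add_left_cancel h

lemma ext_bary {x y : Pt d} (h : ∀ a ∈ T, bary T a x = bary T a y) : x = y := by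
  rw [← hT.sum_bary_smul x, ← hT.sum_bary_smul y]
  exact Finset.sum_congr rfl fun a ha => by rw [h a ha]

lemma ext_bary_linear {x y : Pt d} (h : ∀ a ∈ T, (bary T a).linear x = (bary T a).linear y) :
    x = y := by
  refine hT.ext_bary fun a ha => ?_
  have h1 := affineMap_add_apply (bary T a) 0 x
  have h2 := affineMap_add_apply (bary T a) 0 y
  rw [zero_add] at h1 h2
  rw [h1, h2, h a ha]

lemma mem_hull {x : Pt d} : x ∈ Triangulation.hull T ↔ ∀ a ∈ T, 0 ≤ bary T a x := by
  have h := hT.basis.convexHull_eq_nonneg_coord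
  have hr : Set.range hT.basis = (T : Set (Pt d)) := Subtype.range_coe
  rw [hr] at h
  rw [Triangulation.hull, h]
  simp only [Set.mem_ofPred_eq, Subtype.forall]
  refine forall₂_congr fun a ha => ?_
  rw [← hT.bary_eq_coord ⟨a, ha⟩]

lemma mem_interior_hull {x : Pt d} :
    x ∈ interior (Triangulation.hull T) ↔ ∀ a ∈ T, 0 < bary T a x := by
  have h := hT.basis.interior_convexHull
  have hr : Set.range hT.basis = (T : Set (Pt d)) := Subtype.range_coe
  rw [hr] at h
  rw [Triangulation.hull, h]
  simp only [Set.mem_ofPred_eq, Subtype.forall]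
  refine forall₂_congr fun a ha => ?_
  rw [← hT.bary_eq_coord ⟨a, ha⟩]

lemma apply_center (v : Pt d →ᵃ[ℝ] F) : v (center T) = ((d : ℝ) + 1)⁻¹ • ∑ a ∈ T, v a := by
  have := affineMap_mean v hT.nonempty
  rw [hT.card_eq, Nat.cast_add, Nat.cast_one] at this
  exact this

lemma sum_apply (v : Pt d →ᵃ[ℝ] F) : ∑ a ∈ T, v a = ((d : ℝ) + 1) • v (center T) := by
  rw [hT.apply_center, smul_smul, mul_inv_cancel₀ (by positivity), one_smul]

lemma bary_center {a : Pt d} (ha : a ∈ T) : bary T a (center T) = ((d : ℝ) + 1)⁻¹ := by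
  rw [hT.apply_center, Finset.sum_eq_single_of_mem a ha fun b hb hba => hT.bary_of_ne ha hb hba,
    hT.bary_self ha, smul_eq_mul, mul_one]

lemma center_mem_interior : center T ∈ interior (Triangulation.hull T) := by
  rw [hT.mem_interior_hull]
  intro a ha
  rw [hT.bary_center ha]
  positivity

end IsSimplex

/-! ### Integration over a simplex -/

lemma continuous_affineMap (v : Pt d →ᵃ[ℝ] F) : Continuous v :=
  AffineMap.continuous_linear_iff.1 (LinearMap.continuous_of_finiteDimensional v.linear)

lemma isCompact_hull (T : Finset (Pt d)) : IsCompact (Triangulation.hull T) :=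
  T.finite_toSet.isCompact_convexHull (𝕜 := ℝ)

/-- The volume of the simplex spanned by `T`. -/
def vol (T : Finset (Pt d)) : ℝ := volume.real (Triangulation.hull T)

lemma integrableOn_affineMap (v : Pt d →ᵃ[ℝ] F) (T : Finset (Pt d)) :
    IntegrableOn v (Triangulation.hull T) :=
  (continuous_affineMap v).continuousOn.integrableOn_compact (isCompact_hull T)

lemma IsSimplex.vol_pos {T : Finset (Pt d)} (hT : IsSimplex T) : 0 < vol T := by
  rw [vol, measureReal_def, ENNReal.toReal_pos_iff]
  refine ⟨lt_of_lt_of_le ?_ (measure_mono (interior_subset (s := Triangulation.hull T))),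
    (isCompact_hull T).measure_lt_top⟩
  exact isOpen_interior.measure_pos _ ⟨_, hT.center_mem_interior⟩

/-- The affine map `x ↦ x + ℓ(x) w`. -/
def shear (ℓ : Pt d →ᵃ[ℝ] ℝ) (w : Pt d) : Pt d →ᵃ[ℝ] Pt d where
  toFun x := x + ℓ x • w
  linear := LinearMap.transvection ℓ.linear w
  map_vadd' x v := by
    simp only [vadd_eq_add, LinearMap.transvection.apply]
    rw [add_comm v x, affineMap_add_apply, add_smul]
    abel

lemma shear_apply (ℓ : Pt d →ᵃ[ℝ] ℝ) (w x : Pt d) : shear ℓ w x = x + ℓ x • w := rfl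

lemma volume_image_shear (ℓ : Pt d →ᵃ[ℝ] ℝ) (w : Pt d) (s : Set (Pt d)) :
    volume (shear ℓ w '' s) = ENNReal.ofReal |1 + ℓ.linear w| * volume s := by
  have h : shear ℓ w '' s = (fun x => ℓ 0 • w + x) '' (LinearMap.transvection ℓ.linear w '' s) := by
    rw [Set.image_image]
    refine Set.image_congr fun x _ => ?_
    have := affineMap_add_apply ℓ 0 x
    rw [zero_add] at this
    rw [shear_apply, this, LinearMap.transvection.apply, add_smul]
    abel
  rw [h, Set.image_add_left, measure_preimage_add, Measure.addHaar_image_linearMap,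
    LinearMap.transvection.det]

open Classical in
/-- Two simplices with a common side: the volumes are proportional to the heights. -/
lemma vol_eq_of_common_side {T₁ T₂ S : Finset (Pt d)} {a b : Pt d} (h₁ : IsSimplex T₁)
    (ha : a ∉ S) (hT₁ : T₁ = insert a S) (hT₂ : T₂ = insert b S) :
    vol T₂ = |bary T₁ a b| * vol T₁ := by
  have haT : a ∈ T₁ := by simp [hT₁]
  -- The shear fixes `S`, where λ_a vanishes, and sends a to b. Its determinant is 1 + λ_a(b) -
  -- λ_a(a) = λ_a(b).
  have himg : shear (bary T₁ a) (b - a) '' Triangulation.hull T₁ = Triangulation.hull T₂ := by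
    rw [Triangulation.hull, Triangulation.hull, AffineMap.image_convexHull, hT₁, hT₂,
      Finset.coe_insert, Finset.coe_insert, Set.image_insert_eq, ← hT₁]
    congr 2
    · rw [shear_apply, h₁.bary_self haT]
      simp
    · conv_rhs => rw [← Set.image_id (S : Set (Pt d))]
      refine Set.image_congr fun s hs => ?_
      have hs' : s ∈ S := hs
      rw [shear_apply, h₁.bary_of_ne haT (by simp [hT₁, hs']) (by rintro rfl; exact ha hs')]
      simp
  rw [vol, vol, measureReal_def, measureReal_def, ← himg, volume_image_shear, ENNReal.toReal_mul,
    ENNReal.toReal_ofReal (abs_nonneg _), ← affineMap_sub, h₁.bary_self haT]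
  ring_nf

/-- The affine map that swaps a and b and fixes the other vertices maps the simplex to itself,
preserves volume (determinant -1) and exchanges the two coordinates. -/
lemma IsSimplex.setIntegral_bary_eq {T : Finset (Pt d)} (hT : IsSimplex T) {a b : Pt d}
    (ha : a ∈ T) (hb : b ∈ T) :
    ∫ x in Triangulation.hull T, bary T a x = ∫ x in Triangulation.hull T, bary T b x := by
  rcases eq_or_ne a b with rfl | hab
  · rfl
  set σ := shear (bary T a - bary T b) (b - a) with hσ
  have hlin : (bary T a - bary T b).linear (b - a) = -2 := by
    rw [← affineMap_sub]
    simp only [AffineMap.coe_sub, Pi.sub_apply, hT.bary_self ha, hT.bary_self hb,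
      hT.bary_of_ne ha hb hab.symm, hT.bary_of_ne hb ha hab]
    norm_num
  have hσa (x : Pt d) (c : Pt d) : bary T c (σ x) =
      bary T c x + (bary T a x - bary T b x) * (bary T c b - bary T c a) := by
    rw [hσ, shear_apply, affineMap_add_apply, map_smul, ← affineMap_sub]
    simp
  have h1 (x : Pt d) : bary T a (σ x) = bary T b x := by
    rw [hσa, hT.bary_self ha, hT.bary_of_ne ha hb hab.symm]
    ring
  have h2 (x : Pt d) : bary T b (σ x) = bary T a x := by
    rw [hσa, hT.bary_self hb, hT.bary_of_ne hb ha hab]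
    ring
  have h3 (x : Pt d) (c : Pt d) (hc : c ∈ T) (hca : c ≠ a) (hcb : c ≠ b) :
      bary T c (σ x) = bary T c x := by
    rw [hσa, hT.bary_of_ne hc hb hcb.symm, hT.bary_of_ne hc ha hca.symm]
    ring
  have hinv : Function.Involutive σ := by
    intro x
    refine hT.ext_bary fun c hc => ?_
    rcases eq_or_ne c a with rfl | hca
    · rw [h1, h2]
    rcases eq_or_ne c b with rfl | hcb
    · rw [h2, h1]
    rw [h3 _ c hc hca hcb, h3 _ c hc hca hcb]
  have hpre : σ ⁻¹' Triangulation.hull T = Triangulation.hull T := by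
    have hsub (x : Pt d) (hx : x ∈ Triangulation.hull T) : σ x ∈ Triangulation.hull T := by
      rw [hT.mem_hull] at hx ⊢
      intro c hc
      rcases eq_or_ne c a with rfl | hca
      · rw [h1]; exact hx _ hb
      rcases eq_or_ne c b with rfl | hcb
      · rw [h2]; exact hx _ ha
      rw [h3 _ c hc hca hcb]; exact hx _ hc
    ext x
    refine ⟨fun hx => ?_, hsub x⟩
    have := hsub _ hx
    rwa [hinv x] at this
  have hcont : Continuous σ := continuous_affineMap σ
  have hmp : MeasurePreserving σ volume volume := by
    refine ⟨hcont.measurable, Measure.ext fun s hs => ?_⟩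
    rw [Measure.map_apply hcont.measurable hs, ← Set.image_eq_preimage_of_inverse hinv hinv,
      hσ, volume_image_shear, hlin]
    norm_num
  have := hmp.setIntegral_preimage_emb (hcont.measurableEmbedding hinv.injective)
    (fun x => bary T a x) (Triangulation.hull T)
  rw [hpre] at this
  rw [← this]
  simp only [h1]

/-- The d + 1 barycentric coordinates have equal integrals and sum to 1, so each integrates to
vol(T)/(d+1). -/
lemma IsSimplex.setIntegral_affine [CompleteSpace F] {T : Finset (Pt d)} (hT : IsSimplex T) (v : Pt d →ᵃ[ℝ] F) :
    ∫ x in Triangulation.hull T, v x = vol T • v (center T) := by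
  obtain ⟨b, hb⟩ := hT.nonempty
  have hsum : ∑ a ∈ T, ∫ x in Triangulation.hull T, bary T a x = vol T := by
    rw [← integral_finsetSum _ fun a _ => integrableOn_affineMap (bary T a) T]
    simp_rw [hT.sum_bary]
    simp [vol]
  rw [Finset.sum_congr rfl fun a ha => hT.setIntegral_bary_eq ha hb, Finset.sum_const, hT.card_eq,
    nsmul_eq_mul] at hsum
  rw [funext (hT.apply_eq_sum v),
    integral_finsetSum _ fun a _ => (integrableOn_affineMap (bary T a) T).smul_const (v a),
    Finset.smul_sum]
  refine Finset.sum_congr rfl fun a ha => ?_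
  rw [integral_smul_const, hT.setIntegral_bary_eq ha hb, smul_smul, hT.bary_center ha, ← hsum]
  push_cast
  congr 1
  field_simp

end DiscreteDuality

namespace DiscreteDuality

open Triangulation (sideBarycenter IsOutwardNormal hull)

/-! ### Affine fields on a single simplex -/

variable {d : ℕ}

lemma inner_gradient_affine (v : Pt d →ᵃ[ℝ] ℝ) (x w : Pt d) :
    inner ℝ (gradient v x) w = v.linear w := by
  have h : HasFDerivAt v (LinearMap.toContinuousLinearMap v.linear) x := by
    rw [v.decomp]
    exact (LinearMap.toContinuousLinearMap v.linear).hasFDerivAt.add_const _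
  rw [gradient, InnerProductSpace.toDual_symm_apply, h.fderiv]
  rfl

namespace IsSimplex

open Classical

variable {T : Finset (Pt d)} (hT : IsSimplex T) {a : Pt d} (ha : a ∈ T)

include hT ha

lemma card_erase : (T.erase a).card = d := by
  rw [Finset.card_erase_of_mem ha, hT.card_eq, Nat.add_sub_cancel]

lemma erase_nonempty (hd : 1 ≤ d) : (T.erase a).Nonempty := by
  rw [← Finset.card_pos, hT.card_erase ha]
  exact hd

/-- The value of an affine function at the barycenter of a side. -/
lemma apply_sideBarycenter (hd : 1 ≤ d) (v : Pt d →ᵃ[ℝ] ℝ) :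
    (d : ℝ) * v (sideBarycenter (T.erase a)) = ((d : ℝ) + 1) * v (center T) - v a := by
  have h := affineMap_mean v (hT.erase_nonempty ha hd)
  rw [hT.card_erase ha] at h
  have hd0 : (d : ℝ) ≠ 0 := by exact_mod_cast (by omega : d ≠ 0)
  rw [sideBarycenter, h, smul_eq_mul, mul_inv_cancel_left₀ hd0, ← smul_eq_mul (_ + _),
    ← hT.sum_apply, ← Finset.add_sum_erase T (fun a => v a) ha]
  simp

lemma bary_sideBarycenter_self (hd : 1 ≤ d) : bary T a (sideBarycenter (T.erase a)) = 0 := by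
  have h := hT.apply_sideBarycenter ha hd (bary T a)
  have hd0 : (d : ℝ) ≠ 0 := by exact_mod_cast (by omega : d ≠ 0)
  rw [hT.bary_center ha, hT.bary_self ha, mul_inv_cancel₀ (by positivity), sub_self] at h
  exact (mul_eq_zero.1 h).resolve_left hd0

lemma bary_sideBarycenter (hd : 1 ≤ d) {b : Pt d} (hb : b ∈ T) (hab : b ≠ a) :
    (d : ℝ) * bary T b (sideBarycenter (T.erase a)) = 1 := by
  rw [hT.apply_sideBarycenter ha hd (bary T b), hT.bary_center hb, hT.bary_of_ne hb ha hab.symm,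
    mul_inv_cancel₀ (by positivity), sub_zero]

lemma bary_eq_zero_of_mem_side {x : Pt d} (hx : x ∈ hull (T.erase a)) : bary T a x = 0 := by
  have hconv : Convex ℝ {x | bary T a x = 0} := by
    have := (convex_singleton (𝕜 := ℝ) (0 : ℝ)).affine_preimage (bary T a)
    exact this
  refine convexHull_min (fun s hs => ?_) hconv hx
  have hs' : s ∈ T.erase a := hs
  exact hT.bary_of_ne ha (Finset.mem_of_mem_erase hs') (Finset.ne_of_mem_erase hs')

/-- Both n and ∇λ_a are orthogonal to the side, and their signs are compared at a. This replaces
unit normals by gradients of barycentric coordinates. -/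
lemma outwardNormal_inner (hd : 1 ≤ d) {n : Pt d} (hn : IsOutwardNormal T (T.erase a) n) :
    ∃ c : ℝ, 0 < c ∧ ∀ w, inner ℝ n w = -c * (bary T a).linear w := by
  obtain ⟨x₀, hx₀⟩ := hT.erase_nonempty ha hd
  refine ⟨-inner ℝ n (a - x₀), by simpa using hn.2.2 x₀ hx₀ a ha (by simp), fun w => ?_⟩
  have h := hT.linear_eq_sum (innerₛₗ ℝ n).toAffineMap w
  have h0 : ∑ s ∈ T, (bary T s).linear w • (inner ℝ n x₀ : ℝ) = 0 := by
    rw [← Finset.sum_smul, hT.sum_bary_linear, zero_smul]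
  have h1 : inner ℝ n w = ∑ s ∈ T, (bary T s).linear w • (inner ℝ n (s - x₀) : ℝ) := by
    simp only [inner_sub_right, smul_sub, Finset.sum_sub_distrib, h0, sub_zero]
    exact h
  rw [h1, Finset.sum_eq_single_of_mem a ha, smul_eq_mul]
  · ring
  · intro s hs hsa
    rw [hn.2.1 x₀ hx₀ s (Finset.mem_erase.2 ⟨hsa, hs⟩), smul_zero]

/-- The normalized -∇λ_a. The conditions in `RT` and `RTN` quantify over all outward normals, so
existence is needed to extract any information from them. -/
lemma exists_outwardNormal (hd : 1 ≤ d) : ∃ n : Pt d, IsOutwardNormal T (T.erase a) n := by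
  obtain ⟨x₀, hx₀⟩ := hT.erase_nonempty ha hd
  have hx₀T := Finset.mem_of_mem_erase hx₀
  have hbx (x : Pt d) (hx : x ∈ T.erase a) : bary T a x = 0 :=
    hT.bary_of_ne ha (Finset.mem_of_mem_erase hx) (Finset.ne_of_mem_erase hx)
  set g := gradient (bary T a) 0 with hg
  have hg0 : g ≠ 0 := by
    intro h
    have := inner_gradient_affine (bary T a) 0 (a - x₀)
    rw [← hg, h, inner_zero_left, ← affineMap_sub, hT.bary_self ha, hbx x₀ hx₀] at this
    norm_num at this
  have hgn : 0 < ‖g‖ := norm_pos_iff.2 hg0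
  have hin (x y : Pt d) : inner ℝ (-(‖g‖⁻¹ • g)) (y - x) =
      -(‖g‖⁻¹ * (bary T a y - bary T a x)) := by
    rw [inner_neg_left, real_inner_smul_left, inner_gradient_affine, affineMap_sub]
  refine ⟨-(‖g‖⁻¹ • g), ?_, fun x hx y hy => ?_, fun x hx y hy hyS => ?_⟩
  · rw [norm_neg, norm_smul, norm_inv, norm_norm, inv_mul_cancel₀ hgn.ne']
  · rw [hin, hbx x hx, hbx y hy]
    ring
  · have hya : y = a := by
      by_contra h
      exact hyS (Finset.mem_erase.2 ⟨h, hy⟩)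
    rw [hin, hbx x hx, hya, hT.bary_self ha, sub_zero, mul_one, neg_lt_zero]
    exact inv_pos.2 hgn

omit ha

/-- An affine field whose normal components are constant on the sides of a simplex has the form
`x ↦ c - K x`. -/
lemma exists_of_normal_const {y : Pt d →ᵃ[ℝ] Pt d}
    (hy : ∀ a ∈ T, ∃ c : ℝ, ∀ x ∈ hull (T.erase a), (bary T a).linear (y x) = c) :
    ∃ (K : ℝ) (κ : Pt d → ℝ), (∀ a ∈ T, ∀ x, (bary T a).linear (y x) = κ a - K * bary T a x) ∧
      y.linear = (-K) • LinearMap.id ∧ K = ∑ a ∈ T, κ a := by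
  choose! κ hκ using hy
  have hκ' (a : Pt d) (ha : a ∈ T) (s : Pt d) (hs : s ∈ T) (hsa : s ≠ a) :
      (bary T a).linear (y s) = κ a :=
    hκ a ha s (subset_convexHull ℝ _ (Finset.mem_coe.2 (Finset.mem_erase.2 ⟨hsa, hs⟩)))
  set K := ∑ a ∈ T, κ a with hK
  have hvert (a : Pt d) (ha : a ∈ T) (s : Pt d) (hs : s ∈ T) :
      (bary T a).linear (y s) = κ a - K * bary T a s := by
    rcases eq_or_ne s a with rfl | hsa
    -- The vertex s lies on every side but its own opposite one; the missing component follows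
    -- because the derivatives of the barycentric coordinates sum to zero.
    · have h0 := hT.sum_bary_linear (y s)
      rw [← Finset.add_sum_erase T _ hs] at h0
      rw [← Finset.add_sum_erase T _ hs] at hK
      rw [Finset.sum_congr rfl fun b hb => hκ' b (Finset.mem_of_mem_erase hb) s hs
        (Finset.ne_of_mem_erase hb).symm] at h0
      rw [hT.bary_self hs]
      linarith
    · rw [hκ' a ha s hs hsa, hT.bary_of_ne ha hs hsa]
      ring
  have hall (a : Pt d) (ha : a ∈ T) (x : Pt d) :
      (bary T a).linear (y x) = κ a - K * bary T a x := by
    have := hT.ext_affine (v := (bary T a).linear.toAffineMap.comp y)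
      (w := AffineMap.const ℝ (Pt d) (κ a) - K • bary T a) fun s hs => by
        simpa using hvert a ha s hs
    simpa using congrArg (fun v : Pt d →ᵃ[ℝ] ℝ => v x) this
  refine ⟨K, κ, hall, LinearMap.ext fun w => hT.ext_bary_linear fun a ha => ?_, hK⟩
  have h1 : y.linear w = y (0 + w) - y 0 := by rw [affineMap_add_apply, add_sub_cancel_left]
  rw [h1, map_sub, hall a ha, hall a ha, affineMap_add_apply]
  simp
  ring

/-- The Gauss formula for a Raviart--Thomas field and an affine function on a simplex. -/
lemma gauss_formula (hd : 1 ≤ d) {y : Pt d →ᵃ[ℝ] Pt d}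
    (hy : ∀ a ∈ T, ∃ c : ℝ, ∀ x ∈ hull (T.erase a), (bary T a).linear (y x) = c)
    (v : Pt d →ᵃ[ℝ] ℝ) :
    LinearMap.trace ℝ (Pt d) y.linear * v (center T) + v.linear (y (center T)) =
      -∑ a ∈ T, (d : ℝ) * ((bary T a).linear (y (sideBarycenter (T.erase a))) *
        v (sideBarycenter (T.erase a))) := by
  obtain ⟨K, κ, hκ, hlin, hK⟩ := hT.exists_of_normal_const hy
  have htr : LinearMap.trace ℝ (Pt d) y.linear = -K * d := by
    rw [hlin, map_smul, LinearMap.trace_id]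
    simp
  have h1 : v.linear (y (center T)) = ∑ a ∈ T, κ a * v a - K * v (center T) := by
    rw [hT.linear_eq_sum v, hT.apply_center v, smul_eq_mul, ← mul_assoc, Finset.mul_sum,
      ← Finset.sum_sub_distrib]
    refine Finset.sum_congr rfl fun a ha => ?_
    rw [hκ a ha, hT.bary_center ha, smul_eq_mul]
    ring
  have h2 : ∑ a ∈ T, (d : ℝ) * ((bary T a).linear (y (sideBarycenter (T.erase a))) *
        v (sideBarycenter (T.erase a))) =
      K * (((d : ℝ) + 1) * v (center T)) - ∑ a ∈ T, κ a * v a := by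
    rw [hK, Finset.sum_mul, ← Finset.sum_sub_distrib]
    refine Finset.sum_congr rfl fun a ha => ?_
    rw [mul_left_comm, hT.apply_sideBarycenter ha hd, hκ a ha,
      hT.bary_sideBarycenter_self ha hd]
    ring
  rw [htr, h1, h2]
  ring

end IsSimplex

end DiscreteDuality

/-! ### Geometry of the triangulated domain: covering and disjoint interiors -/

namespace DiscreteDuality

open Triangulation (sideBarycenter IsOutwardNormal hull)
open Filter Topology Classical

variable {d : ℕ} {Ω : Set (Pt d)}

/-- A bounded Lipschitz domain is regular open. -/
lemma IsBoundedLipschitzDomain.interior_closure (hΩ : IsBoundedLipschitzDomain Ω) :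
    interior (closure Ω) = Ω := by
  refine subset_antisymm (fun x hx => ?_) (interior_maximal subset_closure hΩ.isOpen)
  by_contra hxΩ
  have hxf : x ∈ frontier Ω := by
    rw [hΩ.isOpen.frontier_eq]
    exact ⟨interior_subset hx, hxΩ⟩
  obtain ⟨ν, r, L, γ, hν, hr, hγ, hγν, hiff⟩ := hΩ.lipschitz x hxf
  have hcont : Continuous fun y : Pt d => inner ℝ ν y - γ y := by
    have := hγ.continuous
    fun_prop
  have hxle : inner ℝ ν x - γ x ≤ 0 := by
    have := (hiff x (Metric.mem_ball_self hr)).not.1 hxΩ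
    linarith
  -- For small t > 0 the point x - tν is still interior to the closure, but lies strictly below the
  -- graph, where a whole neighbourhood misses `Ω`.
  have htend : Tendsto (fun t : ℝ => x - t • ν) (𝓝[>] 0) (𝓝 x) := by
    have : Continuous fun t : ℝ => x - t • ν := by fun_prop
    have := (this.tendsto 0).mono_left (nhdsWithin_le_nhds (s := Set.Ioi 0))
    simpa using this
  have hev := htend.eventually
    (inter_mem (isOpen_interior.mem_nhds hx) (Metric.ball_mem_nhds x hr))
  obtain ⟨t, ⟨hti, htb⟩, ht⟩ := (hev.and self_mem_nhdsWithin).exists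
  have ht : 0 < t := ht
  have hneg : inner ℝ ν (x - t • ν) - γ (x - t • ν) < 0 := by
    have h1 : γ (x - t • ν) = γ x := by
      have := hγν x (-t)
      rwa [neg_smul, ← sub_eq_add_neg] at this
    rw [h1, inner_sub_right, real_inner_smul_right, real_inner_self_eq_norm_sq, hν]
    linarith
  have hnhds : {y | inner ℝ ν y - γ y < 0} ∩ Metric.ball x r ∈ 𝓝 (x - t • ν) :=
    ((isOpen_lt hcont continuous_const).inter Metric.isOpen_ball).mem_nhds ⟨hneg, htb⟩
  obtain ⟨y, ⟨hy1, hy2⟩, hyΩ⟩ := mem_closure_iff_nhds.1 (interior_subset hti) _ hnhds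
  have := (hiff y hy2).1 hyΩ
  have hy1 : inner ℝ ν y - γ y < 0 := hy1
  linarith

namespace Triangulation

variable (𝒯 : Triangulation Ω)

lemma isSimplex {𝒯 : Triangulation Ω} (T : 𝒯.Elem) : IsSimplex T.1 :=
  ⟨𝒯.complex.indep T.2.1, T.2.2⟩

/-- The side of the element `T` opposite to its vertex `a`. -/
def side {𝒯 : Triangulation Ω} (hd : 1 ≤ d) (T : 𝒯.Elem) {a : Pt d} (ha : a ∈ T.1) : 𝒯.Side :=
  ⟨T.1.erase a, 𝒯.complex.down_closed T.2.1 (Finset.erase_subset _ _)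
    ((isSimplex T).erase_nonempty ha hd), (isSimplex T).card_erase ha⟩

lemma hull_subset_closure (T : 𝒯.Elem) : hull T.1 ⊆ closure Ω := by
  rw [← 𝒯.space_eq]
  exact 𝒯.complex.convexHull_subset_space T.2.1

lemma iUnion_hull : ⋃ T : 𝒯.Elem, hull T.1 = closure Ω := by
  refine subset_antisymm (Set.iUnion_subset fun T => 𝒯.hull_subset_closure T) ?_
  rw [← 𝒯.space_eq]
  intro x hx
  obtain ⟨s, hs, hxs⟩ := Geometry.SimplicialComplex.mem_space_iff.1 hx
  obtain ⟨t, ht, hst, hc⟩ := 𝒯.pure_dim s hs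
  exact Set.mem_iUnion.2 ⟨⟨t, ht, hc⟩, convexHull_mono (Finset.coe_subset.2 hst) hxs⟩

lemma interior_hull_subset (hΩ : IsBoundedLipschitzDomain Ω) (T : 𝒯.Elem) :
    interior (hull T.1) ⊆ Ω := by
  conv_rhs => rw [← hΩ.interior_closure]
  exact interior_mono (𝒯.hull_subset_closure T)

/-- On the intersection of two elements, the barycentric coordinates of the first one at vertices
that do not belong to the second one are zero. -/
lemma bary_nonpos_of_mem_inter {T₁ T₂ : 𝒯.Elem} {a x : Pt d} (ha : a ∈ T₁.1) (ha₂ : a ∉ T₂.1)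
    (h₁ : x ∈ hull T₁.1) (h₂ : x ∈ hull T₂.1) : bary T₁.1 a x ≤ 0 := by
  have hconv : Convex ℝ {x | bary T₁.1 a x ≤ 0} := by
    have := (convex_Iic (𝕜 := ℝ) (0 : ℝ)).affine_preimage (bary T₁.1 a)
    exact this
  refine convexHull_min (fun s hs => ?_) hconv
    (𝒯.complex.inter_subset_convexHull T₁.2.1 T₂.2.1 ⟨h₁, h₂⟩)
  refine ((isSimplex T₁).bary_of_ne ha hs.1 ?_).le
  rintro rfl
  exact ha₂ hs.2

lemma exists_mem_notMem {T₁ T₂ : 𝒯.Elem} (h : T₁ ≠ T₂) : ∃ a ∈ T₁.1, a ∉ T₂.1 := by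
  by_contra! hsub
  exact h (Subtype.ext (Finset.eq_of_subset_of_card_le hsub (by rw [T₁.2.2, T₂.2.2])))

lemma disjoint_interior_hull {T₁ T₂ : 𝒯.Elem} (h : T₁ ≠ T₂) :
    Disjoint (interior (hull T₁.1)) (hull T₂.1) := by
  rw [Set.disjoint_left]
  intro x h₁ h₂
  obtain ⟨a, ha, ha₂⟩ := 𝒯.exists_mem_notMem h
  exact (𝒯.bary_nonpos_of_mem_inter ha ha₂ (interior_subset h₁) h₂).not_gt
    ((isSimplex T₁).mem_interior_hull.1 h₁ a ha)

/-! ### Neighbouring elements -/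

section Neighbours

variable {𝒯} {T₁ T₂ : 𝒯.Elem} {a b : Pt d}

/-- Both coordinates vanish on the common side, so they are proportional; the sign of the factor
tells on which side of it b lies. -/
lemma bary_eq_smul_bary (ha : a ∈ T₁.1) (hb : b ∈ T₂.1) (hS : T₁.1.erase a = T₂.1.erase b) :
    bary T₁.1 a = bary T₁.1 a b • bary T₂.1 b := by
  refine (isSimplex T₂).ext_affine fun s hs => ?_
  rcases eq_or_ne s b with rfl | hsb
  · simp [(isSimplex T₂).bary_self hs]
  · have : s ∈ T₁.1.erase a := hS ▸ Finset.mem_erase.2 ⟨hsb, hs⟩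
    simp [(isSimplex T₂).bary_of_ne hb hs hsb, (isSimplex T₁).bary_of_ne ha
      (Finset.mem_of_mem_erase this) (Finset.ne_of_mem_erase this)]

lemma sideBarycenter_mem_hull (hd : 1 ≤ d) (T : 𝒯.Elem) (ha : a ∈ T.1) :
    sideBarycenter (T.1.erase a) ∈ hull (T.1.erase a) := by
  have hc := (isSimplex T).card_erase ha
  have hd0 : (d : ℝ) ≠ 0 := by exact_mod_cast (by omega : d ≠ 0)
  rw [sideBarycenter, Finset.smul_sum]
  refine (convex_convexHull ℝ _).sum_mem (fun _ _ => by positivity) ?_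
    fun s hs => subset_convexHull ℝ _ hs
  rw [Finset.sum_const, hc, nsmul_eq_mul, mul_inv_cancel₀ hd0]

lemma hull_erase_subset (T : Finset (Pt d)) (a : Pt d) : hull (T.erase a) ⊆ hull T :=
  convexHull_mono (Finset.coe_subset.2 (Finset.erase_subset _ _))

lemma bary_sideBarycenter_pos (hd : 1 ≤ d) (T : 𝒯.Elem) (ha : a ∈ T.1) {s : Pt d}
    (hs : s ∈ T.1) (hsa : s ≠ a) : 0 < bary T.1 s (sideBarycenter (T.1.erase a)) := by
  have h := (isSimplex T).bary_sideBarycenter ha hd hs hsa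
  have hd0 : 0 < (d : ℝ) := by exact_mod_cast hd
  by_contra hneg
  nlinarith [mul_nonneg hd0.le (neg_nonneg.2 (not_lt.1 hneg))]

/-- Two elements with a common side lie on different sides of it. -/
lemma bary_opposite_neg (hd : 1 ≤ d) (hT : T₁ ≠ T₂) (ha : a ∈ T₁.1) (hb : b ∈ T₂.1)
    (hS : T₁.1.erase a = T₂.1.erase b) : bary T₁.1 a b < 0 := by
  have hrel := bary_eq_smul_bary ha hb hS
  rcases lt_trichotomy (bary T₁.1 a b) 0 with h | h | h
  · exact h
  · have h1 := (isSimplex T₁).bary_self ha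
    rw [hrel, h, zero_smul] at h1
    simp at h1
  -- If b were on the same side as a, moving slightly from the side's barycenter towards b would
  -- stay in `T₂` and enter the interior of `T₁`.
  · exfalso
    set x₀ := sideBarycenter (T₁.1.erase a) with hx₀
    have hx₀S := sideBarycenter_mem_hull hd T₁ ha
    have hx₀T₂ : x₀ ∈ hull T₂.1 := hull_erase_subset T₂.1 b (hS ▸ hx₀S)
    have hbT₂ : b ∈ hull T₂.1 := subset_convexHull ℝ _ hb
    have htend : Tendsto (fun t : ℝ => x₀ + t • (b - x₀)) (𝓝[>] 0) (𝓝 x₀) := by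
      have : Continuous fun t : ℝ => x₀ + t • (b - x₀) := by fun_prop
      have := (this.tendsto 0).mono_left (nhdsWithin_le_nhds (s := Set.Ioi 0))
      simpa using this
    have hpos : ∀ᶠ t : ℝ in 𝓝[>] 0, ∀ s ∈ T₁.1.erase a, 0 < bary T₁.1 s (x₀ + t • (b - x₀)) := by
      rw [Finset.eventually_all]
      intro s hs
      have hc := ((continuous_affineMap (bary T₁.1 s)).tendsto x₀).comp htend
      exact hc.eventually_const_lt (bary_sideBarycenter_pos hd T₁ ha (Finset.mem_of_mem_erase hs)
        (Finset.ne_of_mem_erase hs))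
    have hle : ∀ᶠ t : ℝ in 𝓝[>] 0, t ≤ 1 :=
      (eventually_le_nhds one_pos).filter_mono nhdsWithin_le_nhds
    obtain ⟨t, ⟨hts, ht1⟩, ht0⟩ := ((hpos.and hle).and self_mem_nhdsWithin).exists
    have ht0 : 0 < t := ht0
    have h2 : x₀ + t • (b - x₀) ∈ hull T₂.1 :=
      (convex_convexHull ℝ _).add_smul_sub_mem hx₀T₂ hbT₂ ⟨ht0.le, ht1⟩
    refine Set.disjoint_left.1 (𝒯.disjoint_interior_hull hT) ?_ h2
    rw [(isSimplex T₁).mem_interior_hull]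
    intro s hs
    rcases eq_or_ne s a with rfl | hsa
    · rw [affineMap_add_apply, map_smul, ← affineMap_sub,
        (isSimplex T₁).bary_sideBarycenter_self ha hd, zero_add, sub_zero]
      exact mul_pos ht0 h
    · exact hts s (Finset.mem_erase.2 ⟨hsa, hs⟩)

/-- The area vectors of two neighbouring elements on their common side are opposite. -/
lemma vol_mul_bary_linear (hd : 1 ≤ d) (hT : T₁ ≠ T₂) (ha : a ∈ T₁.1) (hb : b ∈ T₂.1)
    (hS : T₁.1.erase a = T₂.1.erase b) (w : Pt d) :
    vol T₂.1 * (bary T₂.1 b).linear w = -(vol T₁.1 * (bary T₁.1 a).linear w) := by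
  have hneg := bary_opposite_neg hd hT ha hb hS
  have hrel : (bary T₁.1 a).linear w = bary T₁.1 a b * (bary T₂.1 b).linear w := by
    conv_lhs => rw [bary_eq_smul_bary ha hb hS]
    rfl
  have hvol := vol_eq_of_common_side (T₂ := T₂.1) (b := b) (isSimplex T₁)
    (Finset.notMem_erase a T₁.1) (Finset.insert_erase ha).symm
    (by rw [hS, Finset.insert_erase hb])
  -- The volume ratio |λ_a(b)| cancels the gradient ratio up to sign, and λ_a(b) is negative.
  rw [hvol, hrel, abs_of_neg hneg]
  ring

/-- A side belongs to at most two elements. -/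
lemma eq_of_common_side (hd : 1 ≤ d) {T₃ : 𝒯.Elem} {c : Pt d} (h₁₂ : T₁ ≠ T₂) (h₃₂ : T₃ ≠ T₂)
    (ha : a ∈ T₁.1) (hb : b ∈ T₂.1) (hc : c ∈ T₃.1) (hab : T₁.1.erase a = T₂.1.erase b)
    (hcb : T₃.1.erase c = T₂.1.erase b) : T₁ = T₃ := by
  by_contra h₁₃
  have h1 := bary_opposite_neg hd h₁₂ ha hb hab
  have h2 := bary_opposite_neg hd h₁₃ ha hc (hab.trans hcb.symm)
  have h3 := bary_opposite_neg hd h₃₂.symm hb hc hcb.symm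
  -- Three elements cannot be pairwise opposite: two sign changes multiply to a positive value of
  -- λ_a(c).
  have h4 : bary T₁.1 a c = bary T₁.1 a b * bary T₂.1 b c := by
    conv_lhs => rw [bary_eq_smul_bary ha hb hab]
    rfl
  nlinarith [mul_pos_of_neg_of_neg h1 h3]

/-- An interior side does not lie on the boundary. -/
lemma not_hull_subset_frontier (hd : 1 ≤ d) (hΩ : IsBoundedLipschitzDomain Ω) (hT : T₁ ≠ T₂)
    (ha : a ∈ T₁.1) (hb : b ∈ T₂.1) (hS : T₁.1.erase a = T₂.1.erase b) :
    ¬ hull (T₁.1.erase a) ⊆ frontier Ω := by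
  intro hfr
  set x₀ := sideBarycenter (T₁.1.erase a) with hx₀
  have hx₀f := hfr (sideBarycenter_mem_hull hd T₁ ha)
  have hneg := bary_opposite_neg hd hT ha hb hS
  have hev (T : 𝒯.Elem) (c : Pt d) (hc : c ∈ T.1) (hx : x₀ = sideBarycenter (T.1.erase c)) :
      ∀ᶠ x in 𝓝 x₀, ∀ s ∈ T.1.erase c, 0 < bary T.1 s x := by
    rw [Finset.eventually_all]
    intro s hs
    refine ((continuous_affineMap (bary T.1 s)).tendsto x₀).eventually_const_lt ?_
    rw [hx]
    exact bary_sideBarycenter_pos hd T hc (Finset.mem_of_mem_erase hs) (Finset.ne_of_mem_erase hs)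
  have hmem (T : 𝒯.Elem) (c x : Pt d) (h : ∀ s ∈ T.1.erase c, 0 < bary T.1 s x)
      (h' : 0 ≤ bary T.1 c x) : x ∈ closure Ω := by
    refine 𝒯.hull_subset_closure T ((isSimplex T).mem_hull.2 fun s hs => ?_)
    rcases eq_or_ne s c with rfl | hsc
    · exact h'
    · exact (h s (Finset.mem_erase.2 ⟨hsc, hs⟩)).le
  -- Near `x₀` only the coordinates at a and b can be negative, and these have opposite signs, so
  -- the two elements cover a neighbourhood.
  have hint : x₀ ∈ interior (closure Ω) := by
    rw [mem_interior_iff_mem_nhds]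
    filter_upwards [hev T₁ a ha rfl, hev T₂ b hb (by rw [hx₀, hS])] with x h1 h2
    rcases le_total 0 (bary T₁.1 a x) with h | h
    · exact hmem T₁ a x h1 h
    · refine hmem T₂ b x h2 ?_
      rw [bary_eq_smul_bary ha hb hS] at h
      have h : bary T₁.1 a b * bary T₂.1 b x ≤ 0 := h
      by_contra hlt
      nlinarith [mul_pos_of_neg_of_neg hneg (not_le.1 hlt)]
  rw [hΩ.interior_closure] at hint
  rw [hΩ.isOpen.frontier_eq] at hx₀f
  exact hx₀f.2 hint

/-- A side that does not lie on the boundary is shared by two elements. -/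
lemma exists_neighbour (hd : 1 ≤ d) (hΩ : IsBoundedLipschitzDomain Ω) (T : 𝒯.Elem)
    (ha : a ∈ T.1) (hfr : ¬ hull (T.1.erase a) ⊆ frontier Ω) :
    ∃ T' : 𝒯.Elem, T ≠ T' ∧ T.1.erase a ⊆ T'.1 := by
  obtain ⟨x, hxS, hxf⟩ := Set.not_subset.1 hfr
  have hxT := hull_erase_subset _ _ hxS
  have hxΩ : x ∈ Ω := by
    by_contra h
    rw [hΩ.isOpen.frontier_eq] at hxf
    exact hxf ⟨𝒯.hull_subset_closure T hxT, h⟩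
  set x₀ := sideBarycenter (T.1.erase a) with hx₀
  have htend (y z : Pt d) : Tendsto (fun t : ℝ => y + t • (z - y)) (𝓝[>] 0) (𝓝 y) := by
    have : Continuous fun t : ℝ => y + t • (z - y) := by fun_prop
    have := (this.tendsto 0).mono_left (nhdsWithin_le_nhds (s := Set.Ioi 0))
    simpa using this
  have hle : ∀ᶠ t : ℝ in 𝓝[>] 0, t ≤ 1 :=
    (eventually_le_nhds one_pos).filter_mono nhdsWithin_le_nhds
  -- Moving x slightly towards the barycenter keeps it in `Ω` and makes all coordinates of the side
  -- positive.
  obtain ⟨t, ⟨htΩ, ht1⟩, ht⟩ := ((((htend x x₀).eventually (hΩ.isOpen.mem_nhds hxΩ)).and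
    hle).and self_mem_nhdsWithin).exists
  have ht : 0 < t := ht
  have hbx (s : Pt d) : bary T.1 s (x + t • (x₀ - x)) =
      (1 - t) * bary T.1 s x + t * bary T.1 s x₀ := by
    rw [affineMap_add_apply, map_smul, ← affineMap_sub, smul_eq_mul]
    ring
  generalize x + t • (x₀ - x) = x₁ at htΩ hbx
  have hpos (s : Pt d) (hs : s ∈ T.1.erase a) : 0 < bary T.1 s x₁ := by
    obtain ⟨hsa, hsT⟩ := Finset.mem_erase.1 hs
    rw [hbx]
    have h1 := (isSimplex T).mem_hull.1 hxT s hsT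
    have h2 := bary_sideBarycenter_pos hd T ha hsT hsa
    have h3 := mul_nonneg (sub_nonneg.2 ht1) h1
    have h4 := mul_pos ht h2
    linarith
  have hzero : bary T.1 a x₁ = 0 := by
    rw [hbx, (isSimplex T).bary_eq_zero_of_mem_side ha hxS,
      (isSimplex T).bary_sideBarycenter_self ha hd]
    ring
  have hx₁T : x₁ ∈ hull T.1 := (isSimplex T).mem_hull.2 fun s hs => by
    rcases eq_or_ne s a with rfl | hsa
    · exact hzero.ge
    · exact (hpos s (Finset.mem_erase.2 ⟨hsa, hs⟩)).le
  have hclosed : IsClosed (⋃ T' : {T' : 𝒯.Elem // T ≠ T'}, hull T'.1.1) :=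
    isClosed_iUnion_of_finite fun T' => (isCompact_hull T'.1.1).isClosed
  -- Points just beyond the side, in direction x₁ - a, lie in `Ω` but not in `T`, hence in other
  -- elements. Their finite union is closed, so it contains `x₁`.
  have hev : ∀ᶠ ε : ℝ in 𝓝[>] 0, x₁ + ε • ((x₁ + x₁ - a) - x₁) ∈
      ⋃ T' : {T' : 𝒯.Elem // T ≠ T'}, hull T'.1.1 := by
    filter_upwards [(htend x₁ (x₁ + x₁ - a)).eventually (hΩ.isOpen.mem_nhds htΩ),
      self_mem_nhdsWithin] with ε hε hε0
    have hε0 : 0 < ε := hε0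
    have hcl := subset_closure (s := Ω) hε
    rw [← 𝒯.iUnion_hull] at hcl
    obtain ⟨T', hT'⟩ := Set.mem_iUnion.1 hcl
    refine Set.mem_iUnion.2 ⟨⟨T', ?_⟩, hT'⟩
    rintro rfl
    have hneg := (isSimplex T).mem_hull.1 hT' a ha
    rw [affineMap_add_apply, map_smul, show x₁ + x₁ - a - x₁ = x₁ - a by abel, ← affineMap_sub,
      hzero, (isSimplex T).bary_self ha, smul_eq_mul] at hneg
    linarith
  obtain ⟨⟨T', hne⟩, hT'⟩ := Set.mem_iUnion.1 (hclosed.mem_of_tendsto (htend _ _) hev)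
  refine ⟨T', hne, fun s hs => ?_⟩
  by_contra hsT'
  exact (𝒯.bary_nonpos_of_mem_inter (Finset.mem_of_mem_erase hs) hsT' hx₁T hT').not_gt (hpos s hs)

end Neighbours

/-! ### Integrals of element-wise constant functions -/

section Integrals

variable {F : Type*} [NormedAddCommGroup F] [NormedSpace ℝ F]

omit [NormedSpace ℝ F] in
lemma glue_eq (w : 𝒯.Elem → Pt d → F) {T : 𝒯.Elem} {x : Pt d} (hx : x ∈ interior (hull T.1)) :
    𝒯.glue w x = w T x := by
  rw [glue, Finset.sum_eq_single_of_mem T (Finset.mem_univ T), Set.indicator_of_mem hx]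
  intro T' _ hT'
  exact Set.indicator_of_notMem
    (fun h => Set.disjoint_left.1 (𝒯.disjoint_interior_hull hT') h (interior_subset hx)) _

lemma interior_hull_ae_eq (T : Finset (Pt d)) : interior (hull T) =ᵐ[volume] hull T :=
  interior_ae_eq_of_null_frontier ((convex_convexHull ℝ _).addHaar_frontier volume)

/-- Boundaries of convex sets are null, and `Ω` is squeezed between the union of the open elements
and its closure. -/
lemma iUnion_interior_ae_eq (hΩ : IsBoundedLipschitzDomain Ω) :
    (⋃ T : 𝒯.Elem, interior (hull T.1) : Set (Pt d)) =ᵐ[volume] Ω := by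
  have h : (⋃ T : 𝒯.Elem, interior (hull T.1) : Set (Pt d)) =ᵐ[volume] closure Ω := by
    rw [← 𝒯.iUnion_hull]
    exact Filter.EventuallyEq.countable_iUnion fun T => interior_hull_ae_eq T.1
  refine (Set.iUnion_subset fun T => 𝒯.interior_hull_subset hΩ T).eventuallyLE.antisymm ?_
  exact subset_closure.eventuallyLE.trans h.symm.le

/-- An open element has positive measure, so a property constant on it cannot fail there on a null
set only. -/
lemma ae_restrict_domain_iff (hΩ : IsBoundedLipschitzDomain Ω) {P : Pt d → Prop} {Q : 𝒯.Elem → Prop}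
    (h : ∀ T : 𝒯.Elem, ∀ x ∈ interior (hull T.1), P x ↔ Q T) :
    (∀ᵐ x ∂(volume.restrict Ω), P x) ↔ ∀ T, Q T := by
  rw [← Measure.restrict_congr_set (𝒯.iUnion_interior_ae_eq hΩ)]
  rw [ae_restrict_iUnion_iff]
  refine forall_congr' fun T => ?_
  rw [ae_restrict_iff' isOpen_interior.measurableSet]
  refine ⟨fun hae => ?_, fun hQ => Eventually.of_forall fun x hx => (h T x hx).2 hQ⟩
  have hne : volume (interior (hull T.1)) ≠ 0 :=
    (isOpen_interior.measure_pos _ ⟨_, (isSimplex T).center_mem_interior⟩).ne'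
  by_contra hQ
  refine hne (measure_mono_null (fun x hx => ?_) (ae_iff.1 hae))
  exact fun hP => hQ ((h T x hx).1 (hP hx))

lemma integral_eq_sum (hΩ : IsBoundedLipschitzDomain Ω) {g : Pt d → ℝ} {c : 𝒯.Elem → ℝ}
    (h : ∀ T : 𝒯.Elem, ∀ x ∈ interior (hull T.1), g x = c T) :
    ∫ x in Ω, g x = ∑ T : 𝒯.Elem, vol T.1 * c T := by
  have hmeas (T : 𝒯.Elem) : MeasurableSet (interior (hull T.1)) := isOpen_interior.measurableSet
  rw [← setIntegral_congr_set (𝒯.iUnion_interior_ae_eq hΩ), integral_iUnion_fintype hmeas]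
  · refine Finset.sum_congr rfl fun T _ => ?_
    rw [setIntegral_congr_fun (hmeas T) (fun x hx => h T x hx), setIntegral_const, vol,
      measureReal_congr (interior_hull_ae_eq T.1), smul_eq_mul]
  · intro T T' hT
    exact (𝒯.disjoint_interior_hull hT).mono_right interior_subset
  · intro T
    refine IntegrableOn.congr_fun (f := fun _ => c T) ?_ (fun x hx => (h T x hx).symm) (hmeas T)
    refine integrableOn_const ?_
    exact ((measure_mono interior_subset).trans_lt (isCompact_hull T.1).measure_lt_top).ne

lemma proj_fn1 [CompleteSpace F] (v : 𝒯.L1 F) (T : 𝒯.Elem) :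
    𝒯.proj (𝒯.fn1 v) T = v T (center T.1) := by
  have hpos := (isSimplex T).vol_pos
  rw [proj, setAverage_eq, ← setIntegral_congr_set (interior_hull_ae_eq T.1),
    setIntegral_congr_fun (f := 𝒯.fn1 v) (g := v T) isOpen_interior.measurableSet
      (fun x hx => 𝒯.glue_eq (fun T x => v T x) hx),
    setIntegral_congr_set (interior_hull_ae_eq T.1), (isSimplex T).setIntegral_affine, smul_smul,
    ← vol, inv_mul_cancel₀ hpos.ne', one_smul]

lemma proj_id (T : 𝒯.Elem) : 𝒯.proj (fun x : Pt d => x) T = center T.1 := by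
  have hpos := (isSimplex T).vol_pos
  have h := (isSimplex T).setIntegral_affine (AffineMap.id ℝ (Pt d))
  simp only [AffineMap.id_apply] at h
  rw [proj, setAverage_eq, h, smul_smul, ← vol, inv_mul_cancel₀ hpos.ne', one_smul]

end Integrals

/-! ### The discrete energies as finite sums -/

section Energies

variable (hΩ : IsBoundedLipschitzDomain Ω) (δ : ℝ) (p : Pt d → ℝ) (ξ : 𝒯.Elem → Pt d)
  (f : Pt d → ℝ)

include hΩ

lemma primal_eq (v : 𝒯.L1 ℝ) : 𝒯.primal δ p ξ f v =
    ∑ T : 𝒯.Elem, vol T.1 * phi δ (p (ξ T)) ‖𝒯.grad v T‖ -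
      ∑ T : 𝒯.Elem, vol T.1 * (𝒯.proj f T * v T (center T.1)) := by
  rw [primal, modular]
  congr 1
  · refine 𝒯.integral_eq_sum hΩ fun T x hx => ?_
    rw [expo, fn0, fn0, 𝒯.glue_eq _ hx, 𝒯.glue_eq _ hx]
  · refine 𝒯.integral_eq_sum hΩ fun T x hx => ?_
    rw [fn0, fn0, 𝒯.glue_eq _ hx, 𝒯.glue_eq _ hx, proj_fn1]

lemma div_eq_iff (y : 𝒯.L1 (Pt d)) :
    (∀ᵐ x ∂(volume.restrict Ω), 𝒯.fn0 (𝒯.div y) x = -𝒯.fn0 (𝒯.proj f) x) ↔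
      ∀ T, 𝒯.div y T = -𝒯.proj f T := by
  refine 𝒯.ae_restrict_domain_iff hΩ fun T x hx => ?_
  rw [fn0, fn0, 𝒯.glue_eq _ hx, 𝒯.glue_eq _ hx]

lemma dual_eq (y : 𝒯.L1 (Pt d)) : 𝒯.dual δ p ξ f y =
    if ∀ T, 𝒯.div y T = -𝒯.proj f T then
      ((-∑ T : 𝒯.Elem, vol T.1 * conj (phi δ (p (ξ T))) ‖y T (center T.1)‖ : ℝ) : EReal)
    else ⊥ := by
  have hmod : modular Ω (fun x => conj (phi δ (𝒯.expo p ξ x))) (𝒯.fn0 (𝒯.proj (𝒯.fn1 y))) =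
      ∑ T : 𝒯.Elem, vol T.1 * conj (phi δ (p (ξ T))) ‖y T (center T.1)‖ := by
    refine 𝒯.integral_eq_sum hΩ fun T x hx => ?_
    simp only [expo, fn0, 𝒯.glue_eq _ hx, proj_fn1]
  have hdiv : (𝒯.fn0 (𝒯.div y) =ᵐ[volume.restrict Ω] fun x => -𝒯.fn0 (𝒯.proj f) x) ↔ _ :=
    𝒯.div_eq_iff hΩ f y
  rw [dual, indicatorFunctional, hmod]
  by_cases h : ∀ T, 𝒯.div y T = -𝒯.proj f T
  · rw [if_pos h, if_pos (hdiv.2 h), sub_zero, EReal.coe_neg]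
  · rw [if_neg h, if_neg (fun h' => h (hdiv.1 h')), EReal.sub_top]

lemma discrete_eq_iff (u v : 𝒯.L1 ℝ) :
    (∫ x in Ω, inner ℝ (opA δ (𝒯.expo p ξ x) (𝒯.fn0 (𝒯.grad u) x)) (𝒯.fn0 (𝒯.grad v) x) =
      ∫ x in Ω, 𝒯.fn0 (𝒯.proj f) x * 𝒯.fn0 (𝒯.proj (𝒯.fn1 v)) x) ↔
    ∑ T : 𝒯.Elem, vol T.1 * (v T).linear (opA δ (p (ξ T)) (𝒯.grad u T)) =
      ∑ T : 𝒯.Elem, vol T.1 * (𝒯.proj f T * v T (center T.1)) := by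
  refine Eq.congr (𝒯.integral_eq_sum hΩ fun T x hx => ?_) (𝒯.integral_eq_sum hΩ fun T x hx => ?_)
  · rw [expo, fn0, fn0, fn0, 𝒯.glue_eq _ hx, 𝒯.glue_eq _ hx, 𝒯.glue_eq _ hx, real_inner_comm]
    exact inner_gradient_affine (v T) 0 _
  · rw [fn0, fn0, 𝒯.glue_eq _ hx, 𝒯.glue_eq _ hx, proj_fn1]

end Energies

/-! ### Raviart--Thomas fields in barycentric coordinates -/

section RaviartThomas

variable {𝒯} {y : 𝒯.L1 (Pt d)} {ΓD : Set (Pt d)}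

lemma normal_const (hd : 1 ≤ d) (hy : y ∈ 𝒯.RT) (T : 𝒯.Elem) {a : Pt d} (ha : a ∈ T.1) :
    ∃ c : ℝ, ∀ x ∈ hull (T.1.erase a), (bary T.1 a).linear (y T x) = c := by
  obtain ⟨n, hn⟩ := (isSimplex T).exists_outwardNormal ha hd
  obtain ⟨k, hk, hkn⟩ := (isSimplex T).outwardNormal_inner ha hd hn
  obtain ⟨c, hc⟩ := hy.1 (side hd T ha) T n (Finset.erase_subset _ _) hn
  refine ⟨-k⁻¹ * c, fun x hx => ?_⟩
  rw [← hc x hx, real_inner_comm, hkn]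
  field_simp

/-- The outward normals of two elements on their common side are opposite. -/
lemma outwardNormal_eq_neg (hd : 1 ≤ d) {T₁ T₂ : 𝒯.Elem} {a b : Pt d} (hT : T₁ ≠ T₂)
    (ha : a ∈ T₁.1) (hb : b ∈ T₂.1) (hS : T₁.1.erase a = T₂.1.erase b) {n₁ n₂ : Pt d}
    (h₁ : IsOutwardNormal T₁.1 (T₁.1.erase a) n₁) (h₂ : IsOutwardNormal T₂.1 (T₁.1.erase a) n₂) :
    n₂ = -n₁ := by
  obtain ⟨k₁, hk₁, hkn₁⟩ := (isSimplex T₁).outwardNormal_inner ha hd h₁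
  obtain ⟨k₂, hk₂, hkn₂⟩ := (isSimplex T₂).outwardNormal_inner hb hd (hS ▸ h₂)
  have hV₁ := (isSimplex T₁).vol_pos
  have hV₂ := (isSimplex T₂).vol_pos
  -- The factor forced by the opposite area vectors; unit length then gives r = 1.
  set r := k₂ * vol T₁.1 / (vol T₂.1 * k₁) with hr
  have hr0 : 0 < r := by positivity
  have hn : n₂ = -(r • n₁) := by
    refine ext_inner_right ℝ fun w => ?_
    rw [inner_neg_left, real_inner_smul_left, hkn₁, hkn₂, hr]
    have := vol_mul_bary_linear hd hT ha hb hS w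
    field_simp
    linear_combination -this
  have hr1 : r = 1 := by
    have h := h₂.1
    rwa [hn, norm_neg, norm_smul, h₁.1, mul_one, Real.norm_of_nonneg hr0.le] at h
  rw [hn, hr1, one_smul]

lemma normal_jump (hd : 1 ≤ d) (hy : y ∈ 𝒯.RT) {T₁ T₂ : 𝒯.Elem} {a b : Pt d} (hT : T₁ ≠ T₂)
    (ha : a ∈ T₁.1) (hb : b ∈ T₂.1) (hS : T₁.1.erase a = T₂.1.erase b) {x : Pt d}
    (hx : x ∈ hull (T₁.1.erase a)) :
    vol T₁.1 * (bary T₁.1 a).linear (y T₁ x) + vol T₂.1 * (bary T₂.1 b).linear (y T₂ x) = 0 := by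
  obtain ⟨n₁, hn₁⟩ := (isSimplex T₁).exists_outwardNormal ha hd
  obtain ⟨n₂, hn₂⟩ := (isSimplex T₂).exists_outwardNormal hb hd
  obtain ⟨k, hk, hkn⟩ := (isSimplex T₁).outwardNormal_inner ha hd hn₁
  rw [← hS] at hn₂
  have h := hy.2 (side hd T₁ ha) T₁ T₂ ⟨hT, Finset.erase_subset _ _,
    hS.trans_subset (Finset.erase_subset _ _)⟩ n₁ n₂ hn₁ hn₂ x hx
  rw [outwardNormal_eq_neg hd hT ha hb hS hn₁ hn₂, inner_neg_right, real_inner_comm,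
    real_inner_comm n₁, hkn, hkn] at h
  rw [vol_mul_bary_linear hd hT ha hb hS]
  have h' : k * ((bary T₁.1 a).linear (y T₁ x) - (bary T₁.1 a).linear (y T₂ x)) = 0 := by
    linear_combination -h
  linear_combination vol T₁.1 * (mul_eq_zero.1 h').resolve_left hk.ne'

/-- A side not contained in `ΓD` may still meet it, but one point outside suffices since the normal
component is constant on the side. -/
lemma normal_boundary (hd : 1 ≤ d) (hy : y ∈ 𝒯.RTN ΓD) (T : 𝒯.Elem) {a : Pt d} (ha : a ∈ T.1)
    (hfr : hull (T.1.erase a) ⊆ frontier Ω) (hD : ¬ hull (T.1.erase a) ⊆ ΓD) {x : Pt d}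
    (hx : x ∈ hull (T.1.erase a)) : (bary T.1 a).linear (y T x) = 0 := by
  obtain ⟨x₀, hx₀, hx₀D⟩ := Set.not_subset.1 hD
  obtain ⟨c, hc⟩ := normal_const hd hy.1 T ha
  obtain ⟨n, hn⟩ := (isSimplex T).exists_outwardNormal ha hd
  obtain ⟨k, hk, hkn⟩ := (isSimplex T).outwardNormal_inner ha hd hn
  have h := hy.2 (side hd T ha) T ⟨Finset.erase_subset _ _, hfr⟩ n hn x₀ ⟨hx₀, hfr hx₀, hx₀D⟩
  rw [real_inner_comm, hkn] at h
  rw [hc x hx, ← hc x₀ hx₀]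
  exact (mul_eq_zero.1 h).resolve_left (neg_ne_zero.2 hk.ne')

end RaviartThomas

/-! ### Summation over the sides of the elements -/

section Flags

variable (𝒯 : Triangulation Ω)

/-- The pairs of an element and one of its vertices, which correspond to the pairs of an element
and one of its sides. -/
def flags : Finset (Σ _ : 𝒯.Elem, Pt d) := Finset.univ.sigma fun T => T.1

/-- The elements that contain the side `S`, with their vertices opposite to it. -/
def flagsAt (S : Finset (Pt d)) : Finset (Σ _ : 𝒯.Elem, Pt d) :=
  𝒯.flags.filter fun q => q.1.1.erase q.2 = S

variable {𝒯}

lemma mem_flagsAt {S : Finset (Pt d)} {q : Σ _ : 𝒯.Elem, Pt d} :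
    q ∈ 𝒯.flagsAt S ↔ q.2 ∈ q.1.1 ∧ q.1.1.erase q.2 = S := by
  simp [flagsAt, flags]

lemma exists_erase_eq {S : Finset (Pt d)} (hS : S.card = d) {T : 𝒯.Elem} (h : S ⊆ T.1) :
    ∃ a ∈ T.1, T.1.erase a = S := by
  obtain ⟨a, ha, haS⟩ := Finset.exists_mem_notMem_of_card_lt_card (s := S) (t := T.1)
    (by rw [hS, T.2.2]; omega)
  refine ⟨a, ha, (Finset.eq_of_subset_of_card_le (fun s hs => ?_) ?_).symm⟩
  · exact Finset.mem_erase.2 ⟨fun h => haS (h ▸ hs), h hs⟩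
  · rw [(isSimplex T).card_erase ha, hS]

lemma eq_of_erase_eq {T : Finset (Pt d)} {a b : Pt d} (ha : a ∈ T)
    (h : T.erase a = T.erase b) : a = b := by
  by_contra hab
  have := Finset.notMem_erase a T
  rw [h] at this
  exact this (Finset.mem_erase.2 ⟨hab, ha⟩)

lemma flagsAt_eq_pair (hd : 1 ≤ d) {T₁ T₂ : 𝒯.Elem} {a b : Pt d} (hT : T₁ ≠ T₂)
    (ha : a ∈ T₁.1) (hb : b ∈ T₂.1) (hS : T₁.1.erase a = T₂.1.erase b) :
    𝒯.flagsAt (T₁.1.erase a) = {⟨T₁, a⟩, ⟨T₂, b⟩} := by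
  ext ⟨T, c⟩
  rw [mem_flagsAt, Finset.mem_insert, Finset.mem_singleton]
  constructor
  · rintro ⟨hc, hcS⟩
    simp only at hc hcS
    rcases eq_or_ne T T₂ with rfl | hne
    · right
      rw [eq_of_erase_eq hc (hcS.trans hS)]
    · left
      obtain rfl := eq_of_common_side hd hT hne ha hb hc hS (hcS.trans hS)
      rw [eq_of_erase_eq hc hcS]
  · rintro (h | h) <;> cases h
    · exact ⟨ha, rfl⟩
    · exact ⟨hb, hS.symm⟩

lemma flagsAt_eq_singleton {T : 𝒯.Elem} {a : Pt d} (ha : a ∈ T.1)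
    (h : ∀ T' : 𝒯.Elem, T.1.erase a ⊆ T'.1 → T = T') :
    𝒯.flagsAt (T.1.erase a) = {⟨T, a⟩} := by
  ext ⟨T', c⟩
  rw [mem_flagsAt, Finset.mem_singleton]
  constructor
  · rintro ⟨hc, hcS⟩
    simp only at hc hcS
    obtain rfl := h T' (hcS ▸ Finset.erase_subset _ _)
    rw [eq_of_erase_eq hc hcS]
  · rintro h
    cases h
    exact ⟨ha, rfl⟩

lemma eq_of_boundary (hd : 1 ≤ d) (hΩ : IsBoundedLipschitzDomain Ω) {T : 𝒯.Elem} {a : Pt d}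
    (ha : a ∈ T.1) (hfr : hull (T.1.erase a) ⊆ frontier Ω) (T' : 𝒯.Elem)
    (h : T.1.erase a ⊆ T'.1) : T = T' := by
  by_contra hne
  obtain ⟨b, hb, hbS⟩ := exists_erase_eq ((isSimplex T).card_erase ha) h
  exact not_hull_subset_frontier hd hΩ hne ha hb hbS.symm hfr

/-- The integration by parts formula for Raviart--Thomas fields and Crouzeix--Raviart functions. -/
lemma sum_gauss (hd : 1 ≤ d) (hΩ : IsBoundedLipschitzDomain Ω) {ΓD : Set (Pt d)}
    {y : 𝒯.L1 (Pt d)} (hy : y ∈ 𝒯.RTN ΓD) {v : 𝒯.L1 ℝ} (hv : v ∈ 𝒯.CRD ΓD) :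
    ∑ T : 𝒯.Elem, vol T.1 * (𝒯.div y T * v T (center T.1) + (v T).linear (y T (center T.1))) =
      0 := by
  set G : (Σ _ : 𝒯.Elem, Pt d) → ℝ := fun q =>
    vol q.1.1 * (bary q.1.1 q.2).linear (y q.1 (sideBarycenter (q.1.1.erase q.2))) *
      v q.1 (sideBarycenter (q.1.1.erase q.2)) with hG
  have h1 : ∑ T : 𝒯.Elem,
      vol T.1 * (𝒯.div y T * v T (center T.1) + (v T).linear (y T (center T.1))) =
      -(d * ∑ q ∈ 𝒯.flags, G q) := by
    rw [flags, Finset.sum_sigma, Finset.mul_sum, ← Finset.sum_neg_distrib]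
    refine Finset.sum_congr rfl fun T _ => ?_
    rw [div, (isSimplex T).gauss_formula hd (fun a ha => normal_const hd hy.1 T ha), mul_neg,
      Finset.mul_sum, Finset.mul_sum]
    congr 1
    refine Finset.sum_congr rfl fun a _ => ?_
    rw [hG]
    ring
  -- Regrouping by sides leaves one term per boundary side and a pair per interior side.
  rw [h1, ← Finset.sum_fiberwise_of_maps_to (t := 𝒯.flags.image fun q => q.1.1.erase q.2)
    (fun q hq => Finset.mem_image_of_mem _ hq), Finset.sum_eq_zero, mul_zero, neg_zero]
  intro S hS
  obtain ⟨⟨T, a⟩, hTa, rfl⟩ := Finset.mem_image.1 hS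
  have ha : a ∈ T.1 := (Finset.mem_sigma.1 hTa).2
  change ∑ q ∈ 𝒯.flagsAt (T.1.erase a), G q = 0
  by_cases hfr : hull (T.1.erase a) ⊆ frontier Ω
  · rw [flagsAt_eq_singleton ha (eq_of_boundary hd hΩ ha hfr), Finset.sum_singleton]
    simp only [hG]
    by_cases hD : hull (T.1.erase a) ⊆ ΓD
    · have hv0 := hv.2 (side hd T ha) T ⟨Finset.erase_subset _ _, hfr⟩ hD
      rw [side] at hv0
      rw [hv0, mul_zero]
    · rw [normal_boundary hd hy T ha hfr hD (sideBarycenter_mem_hull hd T ha), mul_zero, zero_mul]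
  · obtain ⟨T', hne, hsub⟩ := exists_neighbour hd hΩ T ha hfr
    obtain ⟨b, hb, hbS⟩ := exists_erase_eq ((isSimplex T).card_erase ha) hsub
    have hpair : (⟨T, a⟩ : Σ _ : 𝒯.Elem, Pt d) ≠ ⟨T', b⟩ := fun h => hne (Sigma.mk.inj h).1
    rw [flagsAt_eq_pair hd hne ha hb hbS.symm, Finset.sum_pair hpair]
    simp only [hG]
    have hjump := normal_jump hd hy.1 hne ha hb hbS.symm (sideBarycenter_mem_hull hd T ha)
    have hcont := hv.1 (side hd T ha) T T' ⟨hne, Finset.erase_subset _ _, hsub⟩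
    rw [side] at hcont
    rw [hbS, ← sub_eq_zero.1 hcont, ← add_mul, hjump, zero_mul]

end Flags

/-! ### The Crouzeix--Raviart basis -/

section Basis

variable (𝒯 : Triangulation Ω)

/-- The Crouzeix--Raviart basis function of the side `S`. -/
def crBasis (S : Finset (Pt d)) : 𝒯.L1 ℝ := fun T =>
  if S ⊆ T.1 then AffineMap.const ℝ (Pt d) (1 - (d : ℝ)) + (d : ℝ) • ∑ s ∈ S, bary T.1 s else 0

variable {𝒯}

/-- On an element containing `S`, with opposite vertex a, the function is 1 - dλ_a; and λ_a is 0 at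
the barycenter of `S` and 1/d at the other side barycenters. -/
lemma crBasis_sideBarycenter (hd : 1 ≤ d) {S : Finset (Pt d)} (hS : S.card = d) (T : 𝒯.Elem)
    {c : Pt d} (hc : c ∈ T.1) :
    𝒯.crBasis S T (sideBarycenter (T.1.erase c)) = if T.1.erase c = S then 1 else 0 := by
  by_cases h : S ⊆ T.1
  · obtain ⟨a, ha, rfl⟩ := exists_erase_eq hS h
    set x := sideBarycenter (T.1.erase c) with hx
    have hval : 𝒯.crBasis (T.1.erase a) T x = 1 - d * bary T.1 a x := by
      have hsum := (isSimplex T).sum_bary x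
      rw [← Finset.add_sum_erase _ _ ha] at hsum
      have happ : (∑ s ∈ T.1.erase a, bary T.1 s) x = ∑ s ∈ T.1.erase a, bary T.1 s x :=
        map_sum (AddMonoidHom.mk' (fun v : Pt d →ᵃ[ℝ] ℝ => v x) fun _ _ => rfl) _ _
      rw [crBasis, if_pos h, AffineMap.coe_add, Pi.add_apply, AffineMap.const_apply,
        AffineMap.coe_smul, Pi.smul_apply, happ, smul_eq_mul]
      linear_combination (d : ℝ) * hsum
    rw [hval]
    rcases eq_or_ne c a with rfl | hca
    · rw [if_pos rfl, hx, (isSimplex T).bary_sideBarycenter_self hc hd]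
      ring
    · rw [if_neg fun h => hca (eq_of_erase_eq hc h), hx,
        (isSimplex T).bary_sideBarycenter hc hd ha hca.symm, sub_self]
  · rw [crBasis, if_neg h, if_neg]
    · rfl
    · rintro rfl
      exact h (Finset.erase_subset _ _)

lemma crBasis_mem (hd : 1 ≤ d) {ΓD : Set (Pt d)} {S : Finset (Pt d)} (hS : S.card = d)
    (hD : hull S ⊆ frontier Ω → ¬ hull S ⊆ ΓD) : 𝒯.crBasis S ∈ 𝒯.CRD ΓD := by
  refine ⟨fun S' T₁ T₂ h => ?_, fun S' T h hD' => ?_⟩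
  · obtain ⟨a, ha, haS⟩ := exists_erase_eq S'.2.2 h.2.1
    obtain ⟨b, hb, hbS⟩ := exists_erase_eq S'.2.2 h.2.2
    have h1 := crBasis_sideBarycenter hd hS T₁ ha
    have h2 := crBasis_sideBarycenter hd hS T₂ hb
    rw [haS] at h1
    rw [hbS] at h2
    rw [h1, h2, sub_self]
  · obtain ⟨a, ha, haS⟩ := exists_erase_eq S'.2.2 h.1
    have h1 := crBasis_sideBarycenter hd hS T ha
    rw [haS] at h1
    rw [h1, if_neg]
    intro heq
    have hfr := h.2
    rw [heq] at hfr hD'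
    exact hD hfr hD'

end Basis

/-! ### The generalized Marini formula -/

section Marini

variable {𝒯 : Triangulation Ω} {ΓD : Set (Pt d)} {δ : ℝ} {p : Pt d → ℝ} {ξ : 𝒯.Elem → Pt d}
  {f : Pt d → ℝ} {u : 𝒯.L1 ℝ}

lemma marini_apply (T : 𝒯.Elem) (x : Pt d) : 𝒯.marini δ p ξ f u T x =
    opA δ (p (ξ T)) (𝒯.grad u T) - (𝒯.proj f T / d) • (x - center T.1) := by
  rw [← 𝒯.proj_id]
  rfl

lemma marini_center (T : 𝒯.Elem) :
    𝒯.marini δ p ξ f u T (center T.1) = opA δ (p (ξ T)) (𝒯.grad u T) := by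
  rw [marini_apply, sub_self, smul_zero, sub_zero]

lemma marini_linear (T : 𝒯.Elem) :
    (𝒯.marini δ p ξ f u T).linear = (-(𝒯.proj f T / d)) • LinearMap.id := by
  ext1 w
  rw [← sub_zero w, ← affineMap_sub, marini_apply, marini_apply]
  simp only [LinearMap.smul_apply, LinearMap.id_apply]
  module

lemma div_marini (hd : 1 ≤ d) (T : 𝒯.Elem) : 𝒯.div (𝒯.marini δ p ξ f u) T = -𝒯.proj f T := by
  have hd0 : (d : ℝ) ≠ 0 := by exact_mod_cast (by omega : d ≠ 0)
  rw [div, marini_linear, map_smul, LinearMap.trace_id]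
  simp
  field_simp

/-- The field varies only along x - center, and λ_a drops by 1/(d+1) from the center to every point
of the side. -/
lemma marini_normal (T : 𝒯.Elem) {a x : Pt d} (ha : a ∈ T.1) (hx : x ∈ hull (T.1.erase a)) :
    (bary T.1 a).linear (𝒯.marini δ p ξ f u T x) =
      (bary T.1 a).linear (opA δ (p (ξ T)) (𝒯.grad u T)) +
        𝒯.proj f T / d * ((d : ℝ) + 1)⁻¹ := by
  rw [marini_apply, map_sub, map_smul, ← affineMap_sub, (isSimplex T).bary_center ha,
    (isSimplex T).bary_eq_zero_of_mem_side ha hx, smul_eq_mul]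
  ring

/-- The discrete equation tested with the basis function of `S`: after the Gauss formula only the
terms at the barycenter of `S` survive. -/
lemma sum_marini_normal (hd : 1 ≤ d) (hΩ : IsBoundedLipschitzDomain Ω)
    (hu : 𝒯.IsDiscreteSolution ΓD δ p ξ f u) {S : Finset (Pt d)} (hS : S.card = d)
    (hD : hull S ⊆ frontier Ω → ¬ hull S ⊆ ΓD) :
    ∑ q ∈ 𝒯.flagsAt S, vol q.1.1 *
      (bary q.1.1 q.2).linear (𝒯.marini δ p ξ f u q.1 (sideBarycenter S)) = 0 := by
  have hd0 : (d : ℝ) ≠ 0 := by exact_mod_cast (by omega : d ≠ 0)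
  have h := (𝒯.discrete_eq_iff hΩ δ p ξ f u (𝒯.crBasis S)).1
    (hu.2 _ (crBasis_mem hd hS hD))
  rw [← sub_eq_zero, ← Finset.sum_sub_distrib] at h
  have h1 : ∑ T : 𝒯.Elem, (vol T.1 * (𝒯.crBasis S T).linear (opA δ (p (ξ T)) (𝒯.grad u T)) -
      vol T.1 * (𝒯.proj f T * 𝒯.crBasis S T (center T.1))) =
      -(d * ∑ q ∈ 𝒯.flagsAt S, vol q.1.1 *
        (bary q.1.1 q.2).linear (𝒯.marini δ p ξ f u q.1 (sideBarycenter S))) := by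
    rw [flagsAt, Finset.sum_filter, flags, Finset.sum_sigma, Finset.mul_sum,
      ← Finset.sum_neg_distrib]
    refine Finset.sum_congr rfl fun T _ => ?_
    have hg := (isSimplex T).gauss_formula hd (y := 𝒯.marini δ p ξ f u T)
      (fun a ha => ⟨_, fun x hx => marini_normal T ha hx⟩) (𝒯.crBasis S T)
    have hdiv := div_marini (δ := δ) (p := p) (ξ := ξ) (f := f) (u := u) hd T
    rw [div] at hdiv
    rw [hdiv, marini_center] at hg
    have hsum : ∑ a ∈ T.1, (d : ℝ) * ((bary T.1 a).linear
        (𝒯.marini δ p ξ f u T (sideBarycenter (T.1.erase a))) *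
          𝒯.crBasis S T (sideBarycenter (T.1.erase a))) =
        d * ∑ a ∈ T.1, if T.1.erase a = S then
          (bary T.1 a).linear (𝒯.marini δ p ξ f u T (sideBarycenter S)) else 0 := by
      rw [Finset.mul_sum]
      refine Finset.sum_congr rfl fun a ha => ?_
      rw [crBasis_sideBarycenter hd hS T ha]
      split_ifs with h
      · rw [h, mul_one]
      · rw [mul_zero]
    rw [hsum] at hg
    have hout : (∑ a ∈ T.1, if T.1.erase a = S then
        vol T.1 * (bary T.1 a).linear (𝒯.marini δ p ξ f u T (sideBarycenter S)) else 0) =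
        vol T.1 * ∑ a ∈ T.1, if T.1.erase a = S then
          (bary T.1 a).linear (𝒯.marini δ p ξ f u T (sideBarycenter S)) else 0 := by
      rw [Finset.mul_sum]
      exact Finset.sum_congr rfl fun a _ => by rw [mul_ite, mul_zero]
    rw [hout]
    linear_combination vol T.1 * hg
  rw [h1, neg_eq_zero] at h
  exact (mul_eq_zero.1 h).resolve_left hd0

/-- The flux balance holds at side barycenters and extends to whole sides because normal components
are constant. It has two terms on an interior side and one on a boundary side. -/
lemma marini_mem (hd : 1 ≤ d) (hΩ : IsBoundedLipschitzDomain Ω)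
    (hu : 𝒯.IsDiscreteSolution ΓD δ p ξ f u) : 𝒯.marini δ p ξ f u ∈ 𝒯.RTN ΓD := by
  refine ⟨⟨fun S T n hST hn => ?_, fun S T₁ T₂ h n₁ n₂ hn₁ hn₂ x hx => ?_⟩,
    fun S T h n hn x hx => ?_⟩
  · obtain ⟨a, ha, haS⟩ := exists_erase_eq S.2.2 hST
    rw [← haS] at hn ⊢
    obtain ⟨k, -, hkn⟩ := (isSimplex T).outwardNormal_inner ha hd hn
    refine ⟨-k * ((bary T.1 a).linear (opA δ (p (ξ T)) (𝒯.grad u T)) +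
      𝒯.proj f T / d * ((d : ℝ) + 1)⁻¹), fun x hx => ?_⟩
    rw [real_inner_comm, hkn, marini_normal T ha hx]
  · obtain ⟨a, ha, haS⟩ := exists_erase_eq S.2.2 h.2.1
    obtain ⟨b, hb, hbS⟩ := exists_erase_eq S.2.2 h.2.2
    rw [← haS] at hn₁ hn₂ hx hbS
    obtain ⟨k, -, hkn⟩ := (isSimplex T₁).outwardNormal_inner ha hd hn₁
    have hsum := sum_marini_normal hd hΩ hu ((isSimplex T₁).card_erase ha)
      fun hfr => absurd hfr (not_hull_subset_frontier hd hΩ h.1 ha hb hbS.symm)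
    have hpair : (⟨T₁, a⟩ : Σ _ : 𝒯.Elem, Pt d) ≠ ⟨T₂, b⟩ := fun h' => h.1 (Sigma.mk.inj h').1
    have hm := sideBarycenter_mem_hull hd T₁ ha
    have hx₂ := hx
    have hm₂ := hm
    rw [flagsAt_eq_pair hd h.1 ha hb hbS.symm, Finset.sum_pair hpair] at hsum
    simp only at hsum
    rw [marini_normal T₁ ha hm, ← marini_normal T₁ ha hx] at hsum
    rw [← hbS] at hx₂ hm₂ hsum
    rw [marini_normal T₂ hb hm₂, ← marini_normal T₂ hb hx₂,
      vol_mul_bary_linear hd h.1 ha hb hbS.symm, ← mul_neg, ← mul_add] at hsum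
    have hz := (mul_eq_zero.1 hsum).resolve_left (isSimplex T₁).vol_pos.ne'
    rw [outwardNormal_eq_neg hd h.1 ha hb hbS.symm hn₁ hn₂, inner_neg_right, real_inner_comm,
      real_inner_comm n₁, hkn, hkn]
    linear_combination -k * hz
  · obtain ⟨a, ha, haS⟩ := exists_erase_eq S.2.2 h.1
    have hfr := h.2
    rw [← haS] at hn hx hfr
    obtain ⟨k, -, hkn⟩ := (isSimplex T).outwardNormal_inner ha hd hn
    -- The point x lies outside `ΓD`, so the side is not Dirichlet and its basis function is an
    -- admissible test function.
    have hsum := sum_marini_normal hd hΩ hu ((isSimplex T).card_erase ha)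
      fun _ hD => hx.2.2 (hD hx.1)
    rw [flagsAt_eq_singleton ha (eq_of_boundary hd hΩ ha hfr), Finset.sum_singleton] at hsum
    simp only at hsum
    rw [marini_normal T ha (sideBarycenter_mem_hull hd T ha), ← marini_normal T ha hx.1] at hsum
    rw [real_inner_comm, hkn, (mul_eq_zero.1 hsum).resolve_left (isSimplex T).vol_pos.ne', mul_zero]

end Marini

/-! ### Discrete duality -/

section Duality

variable {𝒯 : Triangulation Ω} {ΓD : Set (Pt d)} {δ : ℝ} {p : Pt d → ℝ} {ξ : 𝒯.Elem → Pt d}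
  {f : Pt d → ℝ} {u : 𝒯.L1 ℝ}

/-- The duality gap as a sum of the local gaps in the Fenchel--Young inequality. -/
lemma duality_gap (hd : 1 ≤ d) (hΩ : IsBoundedLipschitzDomain Ω) {y : 𝒯.L1 (Pt d)}
    (hy : y ∈ 𝒯.RTN ΓD) (hdiv : ∀ T, 𝒯.div y T = -𝒯.proj f T) {v : 𝒯.L1 ℝ}
    (hv : v ∈ 𝒯.CRD ΓD) :
    𝒯.primal δ p ξ f v + ∑ T : 𝒯.Elem, vol T.1 * conj (phi δ (p (ξ T))) ‖y T (center T.1)‖ =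
      ∑ T : 𝒯.Elem, vol T.1 * (phi δ (p (ξ T)) ‖𝒯.grad v T‖ +
        conj (phi δ (p (ξ T))) ‖y T (center T.1)‖ - inner ℝ (y T (center T.1)) (𝒯.grad v T)) := by
  have h := sum_gauss hd hΩ hy hv
  rw [primal_eq _ hΩ, ← add_zero (∑ T : 𝒯.Elem, vol T.1 * (_ + _ - _)), ← h,
    ← Finset.sum_sub_distrib, ← Finset.sum_add_distrib, ← Finset.sum_add_distrib]
  refine Finset.sum_congr rfl fun T _ => ?_
  rw [hdiv, real_inner_comm, grad, inner_gradient_affine]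
  ring

lemma dual_le_primal (hd : 1 ≤ d) (hΩ : IsBoundedLipschitzDomain Ω) (hδ : 0 ≤ δ)
    (hq : ∀ T, 1 < p (ξ T)) {y : 𝒯.L1 (Pt d)} (hy : y ∈ 𝒯.RTN ΓD) {v : 𝒯.L1 ℝ}
    (hv : v ∈ 𝒯.CRD ΓD) : 𝒯.dual δ p ξ f y ≤ 𝒯.primal δ p ξ f v := by
  rw [dual_eq _ hΩ]
  split_ifs with hdiv
  · rw [EReal.coe_le_coe_iff, neg_le_iff_add_nonneg, duality_gap hd hΩ hy hdiv hv]
    exact Finset.sum_nonneg fun T _ => mul_nonneg (isSimplex T).vol_pos.le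
      (sub_nonneg.2 (inner_le_phi_add_conj hδ (hq T) _ _))
  · exact bot_le

lemma primal_eq_dual_marini (hd : 1 ≤ d) (hΩ : IsBoundedLipschitzDomain Ω) (hδ : 0 ≤ δ)
    (hq : ∀ T, 1 < p (ξ T)) (hu : 𝒯.IsDiscreteSolution ΓD δ p ξ f u) :
    (𝒯.primal δ p ξ f u : EReal) = 𝒯.dual δ p ξ f (𝒯.marini δ p ξ f u) := by
  rw [dual_eq _ hΩ, if_pos (div_marini hd), EReal.coe_eq_coe_iff, eq_neg_iff_add_eq_zero,
    duality_gap hd hΩ (marini_mem hd hΩ hu) (div_marini hd) hu.1]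
  refine Finset.sum_eq_zero fun T _ => ?_
  rw [marini_center, phi_add_conj_opA hδ (hq T), sub_self, mul_zero]

/-- The nonnegative local gaps must all vanish. Strict convexity then fixes the value at each
center, and the divergence fixes the linear part, a multiple of the identity. -/
lemma eq_marini_of_primal_le_dual (hd : 1 ≤ d) (hΩ : IsBoundedLipschitzDomain Ω) (hδ : 0 ≤ δ)
    (hq : ∀ T, 1 < p (ξ T)) (hu : u ∈ 𝒯.CRD ΓD) {z : 𝒯.L1 (Pt d)}
    (hz : z ∈ 𝒯.RTN ΓD) (h : (𝒯.primal δ p ξ f u : EReal) ≤ 𝒯.dual δ p ξ f z) :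
    z = 𝒯.marini δ p ξ f u := by
  have hd0 : (d : ℝ) ≠ 0 := by exact_mod_cast (by omega : d ≠ 0)
  rw [dual_eq _ hΩ] at h
  split_ifs at h with hdiv
  swap
  · exact absurd (le_bot_iff.1 h) (EReal.coe_ne_bot _)
  have hterm (T : 𝒯.Elem) : 0 ≤ vol T.1 * (phi δ (p (ξ T)) ‖𝒯.grad u T‖ +
      conj (phi δ (p (ξ T))) ‖z T (center T.1)‖ - inner ℝ (z T (center T.1)) (𝒯.grad u T)) :=
    mul_nonneg (isSimplex T).vol_pos.le
      (sub_nonneg.2 (inner_le_phi_add_conj hδ (hq T) _ _))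
  rw [EReal.coe_le_coe_iff, le_neg_iff_add_nonpos_right, duality_gap hd hΩ hz hdiv hu] at h
  have hzero := (Finset.sum_eq_zero_iff_of_nonneg fun T _ => hterm T).1
    (h.antisymm (Finset.sum_nonneg fun T _ => hterm T))
  funext T
  have hc : z T (center T.1) = opA δ (p (ξ T)) (𝒯.grad u T) := by
    refine eq_opA_of_inner_eq hδ (hq T) ?_
    have := (mul_eq_zero.1 (hzero T (Finset.mem_univ T))).resolve_left (isSimplex T).vol_pos.ne'
    linarith
  obtain ⟨K, -, -, hlin, -⟩ :=
    (isSimplex T).exists_of_normal_const fun a ha => normal_const hd hz.1 T ha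
  have hK : K = 𝒯.proj f T / d := by
    have := hdiv T
    rw [div, hlin, map_smul, LinearMap.trace_id] at this
    simp only [finrank_euclideanSpace, Fintype.card_fin, smul_eq_mul] at this
    rw [eq_div_iff hd0]
    linarith
  ext1 x
  have hx (w : Pt d →ᵃ[ℝ] Pt d) : w x = w (center T.1) + w.linear (x - center T.1) := by
    rw [← affineMap_add_apply, add_sub_cancel]
  rw [hx (z T), hx (𝒯.marini δ p ξ f u T), hc, marini_center, hlin, marini_linear, hK]

end Duality

end Triangulation

end DiscreteDuality

end

theorem mainTheorem3 {d : ℕ} (hd : 1 ≤ d)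
    -- the domain, with the Dirichlet part of its boundary
    {Ω : Set (DiscreteDuality.Pt d)} (hΩ : DiscreteDuality.IsBoundedLipschitzDomain Ω)
    (ΓD : Set (DiscreteDuality.Pt d)) (hΓD : ΓD ⊆ frontier Ω) (hΓD_closed : IsClosed ΓD)
    (hΓD_pos : 0 < MeasureTheory.Measure.hausdorffMeasure ((d : ℝ) - 1) ΓD)
    -- the triangulation, with one quadrature point in each element
    (𝒯 : DiscreteDuality.Triangulation Ω) (ξ : 𝒯.Elem → DiscreteDuality.Pt d)
    (hξ : ∀ T : 𝒯.Elem, ξ T ∈ convexHull ℝ (T.1 : Set (DiscreteDuality.Pt d)))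
    -- the shift, the exponent and the right-hand side
    (δ : ℝ) (hδ : 0 ≤ δ) (p : DiscreteDuality.Pt d → ℝ) (hp : ContinuousOn p (closure Ω))
    (hp_one : ∀ x ∈ closure Ω, 1 < p x)
    (f : DiscreteDuality.Pt d → ℝ)
    (hf : DiscreteDuality.MemVarLp Ω (fun x => p x / (p x - 1)) f) :
    -- discrete weak duality
    (⨆ y ∈ 𝒯.RTN ΓD, 𝒯.dual δ p ξ f y) ≤ (⨅ v ∈ 𝒯.CRD ΓD, (𝒯.primal δ p ξ f v : EReal)) ∧
    ∀ u : 𝒯.L1 ℝ, 𝒯.IsDiscreteSolution ΓD δ p ξ f u →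
      -- the reconstructed flux and the discrete optimality relations
      𝒯.marini δ p ξ f u ∈ 𝒯.RTN ΓD ∧
      (∀ᵐ x ∂(MeasureTheory.volume.restrict Ω),
        𝒯.fn0 (𝒯.div (𝒯.marini δ p ξ f u)) x = -𝒯.fn0 (𝒯.proj f) x) ∧
      (∀ᵐ x ∂(MeasureTheory.volume.restrict Ω),
        𝒯.fn0 (𝒯.proj (𝒯.fn1 (𝒯.marini δ p ξ f u))) x =
          DiscreteDuality.opA δ (𝒯.expo p ξ x) (𝒯.fn0 (𝒯.grad u) x)) ∧
      -- it is the unique maximizer of the discrete dual energy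
      (∀ y ∈ 𝒯.RTN ΓD, 𝒯.dual δ p ξ f y ≤ 𝒯.dual δ p ξ f (𝒯.marini δ p ξ f u)) ∧
      (∀ z ∈ 𝒯.RTN ΓD, (∀ y ∈ 𝒯.RTN ΓD, 𝒯.dual δ p ξ f y ≤ 𝒯.dual δ p ξ f z) →
        z = 𝒯.marini δ p ξ f u) ∧
      -- discrete strong duality
      (𝒯.primal δ p ξ f u : EReal) = 𝒯.dual δ p ξ f (𝒯.marini δ p ξ f u) := by
  have hq (T : 𝒯.Elem) : 1 < p (ξ T) := hp_one _ (𝒯.hull_subset_closure T (hξ T))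
  refine ⟨iSup₂_le fun y hy => le_iInf₂ fun v hv =>
    DiscreteDuality.Triangulation.dual_le_primal hd hΩ hδ hq hy hv, fun u hu => ?_⟩
  have hz := DiscreteDuality.Triangulation.marini_mem hd hΩ hu
  have hstrong := DiscreteDuality.Triangulation.primal_eq_dual_marini hd hΩ hδ hq hu
  refine ⟨hz, ?_, ?_, fun y hy => ?_, fun z hzN hmax => ?_, hstrong⟩
  · exact (𝒯.div_eq_iff hΩ f _).2 (DiscreteDuality.Triangulation.div_marini hd)
  · refine (𝒯.ae_restrict_domain_iff hΩ (Q := fun _ => True) fun T x hx => ?_).2 fun _ => trivial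
    rw [iff_true, DiscreteDuality.Triangulation.expo, DiscreteDuality.Triangulation.fn0,
      DiscreteDuality.Triangulation.fn0, DiscreteDuality.Triangulation.fn0, 𝒯.glue_eq _ hx,
      𝒯.glue_eq _ hx, 𝒯.glue_eq _ hx, 𝒯.proj_fn1,
      DiscreteDuality.Triangulation.marini_center]
  · rw [← hstrong]
    exact DiscreteDuality.Triangulation.dual_le_primal hd hΩ hδ hq hy hu.1
  -- By strong duality, any maximizer reaches the primal value of u.
  · refine DiscreteDuality.Triangulation.eq_marini_of_primal_le_dual hd hΩ hδ hq hu.1 hzN ?_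
    rw [hstrong]
    exact hmax _ hz
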